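/- Let $\Omega\subset\mathbb{R}^d$ be a compact set with $|\Omega|=1$, let $\beta>0$, and let $U$ be a set to each of whose elements $u$ is attached a measurable residual $r(u):\Omega\to\mathbb{R}^m$. Write $r^2(u)=|r(u)|^2$. A probability density on $\Omega$ is a measurable function $p\ge 0$ (almost everywhere) with $\int_\Omega p=1$. For a functional $G$ on densities put $$\mathcal J_G(u,p)=\int_\Omega r^2(u)\,p\,dx-\beta\,G(p),$$ with values in $[-\infty,\infty]$ and with value $-\infty$ if $G(p)=+\infty$. (i) Dirichlet energy. Suppose in addition that $\Omega$ is connected and has a Lipschitz boundary. Let $V$ be the set of probability densities on $\Omega$ that belong to $H^1(\Omega)$ (that is, to $H^1$ of the interior of $\Omega$), and let $G_D(p)=\int_\Omega|\nabla p|^2dx$ with $\nabla p$ the weak gradient. If $\inf_{u\in U}\|r^2(u)\|_{L^2(\Omega)}=0$, then $$\inf_{u\in U}\ \sup_{p\in V}\ \mathcal J_{G_D}(u,p)=0 .$$ Moreover, for every sequence $(u_n)$ in $U$ with $\|r^2(u_n)\|_{L^2(\Omega)}<\infty$ for all $n$ and $\|r^2(u_n)\|_{L^2(\Omega)}\to0$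 there are $p_n\in V$ such that each $p_n$ maximizes $\mathcal J_{G_D}(u_n,\cdot)$ over $V$, $\mathcal J_{G_D}(u_n,p_n)\to0$, and $p_n$ converges strongly in $H^1(\Omega)$ to the uniform density $1$. (ii) Negative entropy. Let $P$ be the set of all probability densities on $\Omega$, and let $G_E(p)=\int_\Omega p\log p\,dx\in(-\infty,+\infty]$ with $0\log0=0$. Put $\|r^2(u)\|_{C(\Omega)}=\sup_\Omega r^2(u)$ if $r^2(u)$ is continuous on $\Omega$, and $\|r^2(u)\|_{C(\Omega)}=\infty$ otherwise. If $\inf_{u\in U}\|r^2(u)\|_{C(\Omega)}=0$, then $$\inf_{u\in U}\ \sup_{p\in P}\ \mathcal J_{G_E}(u,p)=0 .$$ Moreover, for every sequence $(u_n)$ in $U$ with $\|r^2(u_n)\|_{C(\Omega)}<\infty$ for all $n$ and $\|r^2(u_n)\|_{C(\Omega)}\to0$ there are $p_n\in P$ such that each $p_n$ maximizes $\mathcal J_{G_E}(u_n,\cdot)$ over $P$, $\mathcal J_{G_E}(u_n,p_n)\to0$, $p_n$ is everywhere positive on $\Omega$ and is the Gibbs density $$p_n(x)=\frac{\exp\big(r^2(u_n)(x)/\beta\big)}{\int_\Omega\exp\big(r^2(u_n)(y)/\beta\big)\,dy}\qquad(x\in\Omega),$$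 and $p_n$ converges uniformly on $\Omega$ to the uniform density $1$. -/

import Mathlib

open MeasureTheory Filter Topology
open scoped ENNReal NNReal ContDiff

namespace AAS

/-- The Euclidean space `ℝ^d`. -/
abbrev E (d : ℕ) : Type := EuclideanSpace ℝ (Fin d)

/-- `Ω` has a Lipschitz boundary: near each of its boundary points, and up to a rotation, `Ω` is the
region below the graph of a Lipschitz function. The direction of the graph is the unit vector `e`;
a function of the hyperplane orthogonal to `e` is written as a function `γ` on the whole space that
is invariant under translations along `e`. -/
def HasLipschitzBoundary {d : ℕ} (Ω : Set (E d)) : Prop :=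
  ∀ x ∈ frontier Ω, ∃ (e : E d) (γ : E d → ℝ) (K : ℝ≥0) (W : Set (E d)),
    ‖e‖ = 1 ∧ LipschitzWith K γ ∧ (∀ (y : E d) (t : ℝ), γ (y + t • e) = γ y) ∧
    IsOpen W ∧ x ∈ W ∧ Ω ∩ W = {y | y ∈ W ∧ inner ℝ y e ≤ γ y}

/-- `g` is a weak gradient of `p` on the open set `O`. -/
def IsWeakGradient {d : ℕ} (O : Set (E d)) (p : E d → ℝ) (g : E d → E d) : Prop :=
  LocallyIntegrableOn p O volume ∧ LocallyIntegrableOn g O volume ∧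
  ∀ φ : E d → ℝ, ContDiff ℝ ∞ φ → HasCompactSupport φ → tsupport φ ⊆ O → ∀ v : E d,
    ∫ x in O, p x * fderiv ℝ φ x v = - ∫ x in O, φ x * inner ℝ (g x) v

open Classical in
/-- The weak gradient of `p` on the open set `O` (unique up to null sets where it exists). -/
noncomputable def weakGradient {d : ℕ} (O : Set (E d)) (p : E d → ℝ) : E d → E d :=
  if h : ∃ g, IsWeakGradient O p g then h.choose else 0

/-- The Sobolev space `H¹(O)`, for an open set `O`. -/
def MemH1 {d : ℕ} (O : Set (E d)) (p : E d → ℝ) : Prop :=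
  MemLp p 2 (volume.restrict O) ∧
    ∃ g : E d → E d, IsWeakGradient O p g ∧ MemLp g 2 (volume.restrict O)

/-- The norm of `H¹(O)`. -/
noncomputable def h1Norm {d : ℕ} (O : Set (E d)) (p : E d → ℝ) : ℝ≥0∞ :=
  (eLpNorm p 2 (volume.restrict O) ^ 2
    + eLpNorm (weakGradient O p) 2 (volume.restrict O) ^ 2) ^ (1 / 2 : ℝ)

/-- `p` is a probability density on `Ω`. -/
def IsDensity {d : ℕ} (Ω : Set (E d)) (p : E d → ℝ) : Prop :=
  AEMeasurable p (volume.restrict Ω) ∧ (∀ᵐ x ∂(volume.restrict Ω), 0 ≤ p x) ∧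
    ∫⁻ x in Ω, ENNReal.ofReal (p x) = 1

/-- All probability densities on `Ω`. -/
def densities {d : ℕ} (Ω : Set (E d)) : Set (E d → ℝ) := {p | IsDensity Ω p}

/-- The probability densities on `Ω` that belong to `H¹(Ω)`, that is, to `H¹` of the interior. -/
def h1Densities {d : ℕ} (Ω : Set (E d)) : Set (E d → ℝ) :=
  {p | IsDensity Ω p ∧ MemH1 (interior Ω) p}

/-- The Dirichlet energy `∫ |∇p|²`. -/
noncomputable def dirichletEnergy {d : ℕ} (Ω : Set (E d)) (p : E d → ℝ) : EReal :=
  ((∫⁻ x in interior Ω, ‖weakGradient (interior Ω) p x‖ₑ ^ 2 : ℝ≥0∞) : EReal)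

open Classical in
/-- The negative entropy `∫ p log p` of a density on a set of finite volume. There the negative
part of `p log p` is bounded, so that the integral is `+∞` if `p log p` is not integrable. -/
noncomputable def negEntropy {d : ℕ} (Ω : Set (E d)) (p : E d → ℝ) : EReal :=
  if IntegrableOn (fun x => p x * Real.log (p x)) Ω volume then
    ((∫ x in Ω, p x * Real.log (p x) : ℝ) : EReal) else ⊤

/-- The functional `∫ |r|² p - β G(p)`, for a residual `r` and a density `p`. The first integral
may be `+∞`; the value is `-∞` if `G(p) = +∞`. -/
noncomputable def functional {d m : ℕ} (Ω : Set (E d)) (β : ℝ) (G : (E d → ℝ) → EReal)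
    (r : E d → E m) (p : E d → ℝ) : EReal :=
  ((∫⁻ x in Ω, ENNReal.ofReal (‖r x‖ ^ 2 * p x) : ℝ≥0∞) : EReal) - (β : EReal) * G p

/-- The norm `‖|r|²‖` in `L²(Ω)` (possibly infinite). -/
noncomputable def sqNormL2 {d m : ℕ} (Ω : Set (E d)) (r : E d → E m) : ℝ≥0∞ :=
  eLpNorm (fun x => ‖r x‖ ^ 2) 2 (volume.restrict Ω)

open Classical in
/-- The norm `‖|r|²‖` in `C(Ω)`; it is infinite if `|r|²` is not continuous on `Ω`. -/
noncomputable def sqNormC {d m : ℕ} (Ω : Set (E d)) (r : E d → E m) : ℝ≥0∞ :=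
  if ContinuousOn (fun x => ‖r x‖ ^ 2) Ω then ⨆ x ∈ Ω, ENNReal.ofReal (‖r x‖ ^ 2) else ⊤

end AAS

/-! Both parts rest on a comparison with the uniform density 1. There the regularizer vanishes, so
every inner supremum is nonnegative. The regularizer is also strong enough to bound the supremum by
a quantity that vanishes with the residual, and to force the maximizer towards 1.

Dirichlet energy. Put R = |r|² in L². Since p - 1 has mean zero, the Poincaré inequality gives ‖p -
1‖ ≤ C‖∇p‖, hence ⟨R, p⟩ - β‖∇p‖² ≤ ‖R‖ + C‖R‖‖∇p‖ - β‖∇p‖², which is bounded in terms of ‖R‖.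
Comparing a maximizer with 1 gives β‖∇p‖² ≤ C‖R‖‖∇p‖, so ‖∇p‖ ≤ C‖R‖/β, and p tends to 1 in H¹. A
maximizer exists because the parallelogram law makes the gradients of a maximizing sequence Cauchy,
and the Poincaré inequality then does the same for the functions (`exists_isMaxOn_sub_sq`); no weak
compactness is needed.

The Poincaré inequality itself is proved by translations, without a compact embedding. The integral
of |P(x + w) - P(x)|² is at most |w|²∫|∇P|² where the segments stay inside the domain
(`H1Pair.lintegral_shift_le`). This bounds the oscillation on balls. A piece of the domain near a
boundary point is slid into an interior ball against the direction of the graph. Overlapping pieces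
are linked by averaging over the overlap, and connectedness and compactness of Ω make the estimate
global (`controls_interior`).

Negative entropy. For the Gibbs density q with normalization Z, the inequality p log q - p log p ≤ q
- p integrates to the statement that no density has value above β log Z, and q attains it. If |r|² ≤
M then 1 ≤ Z ≤ exp(M/β), which bounds both the value and |q - 1| (`gibbs_maximization`). -/

namespace AAS

/-! ### Translates of Sobolev functions -/

/-- `P` and `G` are functions on the whole space, measurable and integrable, and `G` is a
weak gradient of `P` against the test functions supported in `O`. -/
structure H1Pair {d : ℕ} (O : Set (E d)) (P : E d → ℝ) (G : E d → E d) : Prop where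
  measurable_fun : Measurable P
  measurable_grad : Measurable G
  integrable_fun : Integrable P
  integrable_grad : Integrable G
  weak : ∀ φ : E d → ℝ, ContDiff ℝ ∞ φ → HasCompactSupport φ → tsupport φ ⊆ O → ∀ v : E d,
    ∫ x, P x * fderiv ℝ φ x v = - ∫ x, φ x * inner ℝ (G x) v

/-- The unit interval as a measure. -/
noncomputable abbrev unitMeasure : Measure ℝ := volume.restrict (Set.Ioc (0 : ℝ) 1)

instance : IsProbabilityMeasure unitMeasure := ⟨by simp [unitMeasure]⟩

/-- For each fixed time the map is a translation. It supplies the joint integrability in time and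
space that Fubini needs along segments. -/
theorem measurePreserving_shear {d : ℕ} (w : E d) :
    MeasurePreserving (fun z : ℝ × E d => (z.1, z.2 + z.1 • w))
      (unitMeasure.prod volume) (unitMeasure.prod volume) :=
  (MeasurePreserving.id unitMeasure).skew_product (g := fun t x => x + t • w)
    (by fun_prop) (Eventually.of_forall fun t => (measurePreserving_add_right volume (t • w)).map_eq)

theorem integrable_shear {d : ℕ} {F : Type*} [NormedAddCommGroup F] {G : E d → F}
    (hG : Integrable G) (w : E d) :
    Integrable (fun z : ℝ × E d => G (z.2 + z.1 • w)) (unitMeasure.prod volume) :=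
  (measurePreserving_shear w).integrable_comp_of_integrable (hG.comp_snd unitMeasure)

theorem integral_fderiv_segment {d : ℕ} {φ : E d → ℝ} (hφ : ContDiff ℝ ∞ φ) (x w : E d) :
    ∫ t, fderiv ℝ φ (x - t • w) w ∂unitMeasure = φ x - φ (x - w) := by
  have hd : ∀ t : ℝ, HasDerivAt (fun s : ℝ => -φ (x - s • w)) (fderiv ℝ φ (x - t • w) w) t := by
    intro t
    have h1 : HasDerivAt (fun s : ℝ => x - s • w) (-w) t := by
      simpa using ((hasDerivAt_id t).smul_const w).const_sub x
    have h2 := ((hφ.differentiable (by simp)) (x - t • w)).hasFDerivAt.comp_hasDerivAt t h1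
    exact h2.neg.congr_deriv (by simp)
  have hc : Continuous fun t : ℝ => fderiv ℝ φ (x - t • w) w := by
    have := hφ.continuous_fderiv (by simp)
    fun_prop
  have := intervalIntegral.integral_eq_sub_of_hasDerivAt (a := 0) (b := 1) (fun t _ => hd t)
    (hc.intervalIntegrable 0 1)
  rw [intervalIntegral.integral_of_le zero_le_one] at this
  rw [this]; simp; ring

/-- The difference of a Sobolev function and its translate is the integral of the gradient along
the segments. -/
theorem H1Pair.shift_eq {d : ℕ} {O A : Set (E d)} {P : E d → ℝ} {G : E d → E d}
    (h : H1Pair O P G) (hA : IsOpen A) (w : E d)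
    (hAw : ∀ x ∈ A, ∀ t ∈ Set.Icc (0 : ℝ) 1, x + t • w ∈ O) :
    ∀ᵐ x, x ∈ A → P (x + w) - P x = ∫ t, inner ℝ (G (x + t • w)) w ∂unitMeasure := by
  have hk : Integrable (fun z : ℝ × E d => inner ℝ (G (z.2 + z.1 • w)) w)
      (unitMeasure.prod volume) := 
    integrable_shear (G := fun x => inner ℝ (G x) w) (h.integrable_grad.inner_const w) w
  have hPw : Integrable fun x => P (x + w) := h.integrable_fun.comp_add_right w
  have hint : Integrable fun x => ∫ t, inner ℝ (G (x + t • w)) w ∂unitMeasure :=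
    hk.integral_prod_right
  -- The identity is tested against smooth functions supported in `A`, so that only test functions
  -- are ever differentiated.
  have key := hA.ae_eq_zero_of_integral_contDiff_smul_eq_zero (μ := volume)
    (f := fun x => P (x + w) - P x - ∫ t, inner ℝ (G (x + t • w)) w ∂unitMeasure)
    (((hPw.sub h.integrable_fun).sub hint).locallyIntegrable.locallyIntegrableOn A) ?_
  · filter_upwards [key] with x hx hxA using sub_eq_zero.1 (hx hxA)
  intro φ hφ hφc hφA
  obtain ⟨C, hC⟩ := hφc.exists_bound_of_continuous hφ.continuous
  have hφ' : Continuous (fderiv ℝ φ) := hφ.continuous_fderiv (by simp)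
  obtain ⟨C', hC'⟩ := (hφc.fderiv (𝕜 := ℝ)).exists_bound_of_continuous hφ'
  have i1 : Integrable fun x => φ x * P (x + w) :=
    hPw.bdd_mul hφ.continuous.aestronglyMeasurable (Eventually.of_forall hC)
  have i2 : Integrable fun x => φ x * P x :=
    h.integrable_fun.bdd_mul hφ.continuous.aestronglyMeasurable (Eventually.of_forall hC)
  have i3 : Integrable fun x => φ x * ∫ t, inner ℝ (G (x + t • w)) w ∂unitMeasure :=
    hint.bdd_mul hφ.continuous.aestronglyMeasurable (Eventually.of_forall hC)
  have i4 : Integrable (fun x => P x * φ (x - w)) :=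
    h.integrable_fun.mul_bdd (c := C)
      (hφ.continuous.comp (continuous_id.sub continuous_const)).aestronglyMeasurable
      (Eventually.of_forall fun x => hC _)
  have e1 : ∫ x, φ x * P (x + w) = ∫ x, P x * φ (x - w) := by
    rw [← integral_sub_right_eq_self (fun x => φ x * P (x + w)) w]
    simp [mul_comm]
  -- The translation is moved onto the test function. The translate of `φ` by `t • w` is still
  -- admissible, because its support lies in `A + t • w`, hence in `O`.
  have step : ∀ t ∈ Set.Ioc (0 : ℝ) 1, ∫ x, φ x * inner ℝ (G (x + t • w)) w
      = - ∫ x, P x * fderiv ℝ φ (x - t • w) w := by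
    intro t ht
    rw [← integral_sub_right_eq_self _ (t • w)]
    have hw := h.weak (fun x => φ (x - t • w)) (hφ.comp (by fun_prop))
      (hφc.comp_homeomorph (Homeomorph.subRight (t • w))) ?_ w
    · simp only [fderiv_comp_sub] at hw
      simp only [sub_add_cancel]
      rw [hw, neg_neg]
    · have : tsupport (fun x => φ (x - t • w)) = (Homeomorph.subRight (t • w)) ⁻¹' tsupport φ :=
        tsupport_comp_eq_preimage φ (Homeomorph.subRight (t • w))
      rw [this]
      intro x hx
      have := hAw _ (hφA hx) t ⟨ht.1.le, ht.2⟩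
      simpa using this
  have j1 : Integrable (Function.uncurry fun (t : ℝ) (x : E d) =>
      φ x * inner ℝ (G (x + t • w)) w) (unitMeasure.prod volume) :=
    hk.bdd_mul (f := fun z : ℝ × E d => φ z.2)
      (hφ.continuous.comp continuous_snd).aestronglyMeasurable
      (Eventually.of_forall fun z => hC z.2)
  have j2 : Integrable (Function.uncurry fun (t : ℝ) (x : E d) =>
      P x * fderiv ℝ φ (x - t • w) w) (unitMeasure.prod volume) := by
    refine (h.integrable_fun.comp_snd unitMeasure).mul_bdd (c := C' * ‖w‖)
      (g := fun z : ℝ × E d => fderiv ℝ φ (z.2 - z.1 • w) w) ?_ (Eventually.of_forall fun z => ?_)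
    · have : Continuous fun z : ℝ × E d => fderiv ℝ φ (z.2 - z.1 • w) w := by fun_prop
      exact this.aestronglyMeasurable
    · exact (ContinuousLinearMap.le_opNorm _ _).trans
        (mul_le_mul_of_nonneg_right (hC' _) (norm_nonneg _))
  have e2 : ∫ x, φ x * ∫ t, inner ℝ (G (x + t • w)) w ∂unitMeasure
      = - (∫ x, P x * (φ x - φ (x - w))) := by
    calc ∫ x, φ x * ∫ t, inner ℝ (G (x + t • w)) w ∂unitMeasure
        = ∫ x, ∫ t, φ x * inner ℝ (G (x + t • w)) w ∂unitMeasure := by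
          simp only [integral_const_mul]
      _ = ∫ t, ∫ x, φ x * inner ℝ (G (x + t • w)) w ∂volume ∂unitMeasure :=
          (integral_integral_swap j1).symm
      _ = ∫ t, - ∫ x, P x * fderiv ℝ φ (x - t • w) w ∂volume ∂unitMeasure :=
          setIntegral_congr_fun measurableSet_Ioc step
      _ = - ∫ x, ∫ t, P x * fderiv ℝ φ (x - t • w) w ∂unitMeasure := by
          rw [integral_neg, integral_integral_swap j2]
      _ = _ := by simp only [integral_const_mul, integral_fderiv_segment hφ]
  simp only [smul_eq_mul, mul_sub]
  rw [integral_sub (by exact i1.sub i2) i3, integral_sub i1 i2, e1, e2]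
  simp only [mul_sub]
  rw [integral_sub (by simpa only [mul_comm] using i2) i4]
  simp only [mul_comm (P _)]
  ring

theorem sq_lintegral_le {α : Type*} [MeasurableSpace α] {μ : Measure α} [IsProbabilityMeasure μ]
    {f : α → ℝ≥0∞} (hf : AEMeasurable f μ) : (∫⁻ x, f x ∂μ) ^ 2 ≤ ∫⁻ x, f x ^ 2 ∂μ := by
  have := ENNReal.lintegral_mul_le_Lp_mul_Lq μ Real.HolderConjugate.two_two hf
    (aemeasurable_const (b := (1 : ℝ≥0∞)))
  simp only [Pi.mul_apply, mul_one, ENNReal.rpow_ofNat, one_pow, lintegral_const, measure_univ,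
    ENNReal.one_rpow] at this
  calc _ ≤ ((∫⁻ x, f x ^ 2 ∂μ) ^ (1 / 2 : ℝ)) ^ 2 := pow_le_pow_left' this 2
    _ = _ := by rw [← ENNReal.rpow_natCast, ← ENNReal.rpow_mul]; norm_num

/-- Cauchy–Schwarz on the unit interval bounds the squared difference by the mean of |G|² along the
segment. After Fubini, translation invariance makes every time contribute the same energy. -/
theorem H1Pair.lintegral_shift_le {d : ℕ} {O A : Set (E d)} {P : E d → ℝ} {G : E d → E d}
    (h : H1Pair O P G) (hA : IsOpen A) (w : E d)
    (hAw : ∀ x ∈ A, ∀ t ∈ Set.Icc (0 : ℝ) 1, x + t • w ∈ O) :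
    ∫⁻ x in A, ‖P (x + w) - P x‖ₑ ^ 2 ≤ ‖w‖ₑ ^ 2 * ∫⁻ x, ‖G x‖ₑ ^ 2 := by
  have hG := h.measurable_grad
  calc ∫⁻ x in A, ‖P (x + w) - P x‖ₑ ^ 2
      ≤ ∫⁻ x in A, ‖w‖ₑ ^ 2 * ∫⁻ t, ‖G (x + t • w)‖ₑ ^ 2 ∂unitMeasure := by
        refine lintegral_mono_ae ?_
        rw [ae_restrict_iff' hA.measurableSet]
        filter_upwards [h.shift_eq hA w hAw] with x hx hxA
        rw [hx hxA]
        calc ‖∫ t, inner ℝ (G (x + t • w)) w ∂unitMeasure‖ₑ ^ 2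
            ≤ (∫⁻ t, ‖w‖ₑ * ‖G (x + t • w)‖ₑ ∂unitMeasure) ^ 2 := by
              refine pow_le_pow_left' ((enorm_integral_le_lintegral_enorm _).trans
                (lintegral_mono fun t => ?_)) 2
              rw [← ofReal_norm, ← ofReal_norm w, ← ofReal_norm (G _),
                ← ENNReal.ofReal_mul (norm_nonneg _)]
              exact ENNReal.ofReal_le_ofReal (by
                rw [mul_comm]; exact norm_inner_le_norm _ _)
          _ ≤ _ := by
              refine (sq_lintegral_le (by fun_prop)).trans ?_
              simp only [mul_pow]
              rw [lintegral_const_mul _ (by fun_prop)]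
    _ ≤ ∫⁻ x, ‖w‖ₑ ^ 2 * ∫⁻ t, ‖G (x + t • w)‖ₑ ^ 2 ∂unitMeasure := setLIntegral_le_lintegral _ _
    _ = ‖w‖ₑ ^ 2 * ∫⁻ x, ∫⁻ t, ‖G (x + t • w)‖ₑ ^ 2 ∂unitMeasure :=
        lintegral_const_mul' _ _ (by finiteness)
    _ = ‖w‖ₑ ^ 2 * ∫⁻ t, ∫⁻ x, ‖G (x + t • w)‖ₑ ^ 2 ∂volume ∂unitMeasure := by
        rw [lintegral_lintegral_swap]
        have : Measurable (Function.uncurry fun (x : E d) (t : ℝ) => ‖G (x + t • w)‖ₑ ^ 2) := by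
          unfold Function.uncurry; fun_prop
        exact this.aemeasurable
    _ = _ := by
        congr 1
        calc _ = ∫⁻ t, (∫⁻ x, ‖G x‖ₑ ^ 2) ∂unitMeasure :=
              lintegral_congr fun t => lintegral_add_right_eq_self (fun x => ‖G x‖ₑ ^ 2) (t • w)
          _ = _ := by simp

/-! ### Oscillations between pieces of the domain -/

/-- The mean square oscillation of `P` between `A` and `B`. -/
noncomputable def osc {d : ℕ} (P : E d → ℝ) (A B : Set (E d)) : ℝ≥0∞ :=
  ∫⁻ x in A, ∫⁻ y in B, ‖P x - P y‖ₑ ^ 2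

/-- The oscillation between `A` and `B` is bounded by the Dirichlet energy on `O`. -/
def Controls {d : ℕ} (O A B : Set (E d)) : Prop :=
  ∃ C : ℝ≥0∞, C ≠ ⊤ ∧ ∀ P G, H1Pair O P G → osc P A B ≤ C * ∫⁻ x, ‖G x‖ₑ ^ 2

theorem enorm_sub_sq_le (a b c : ℝ) : ‖a - c‖ₑ ^ 2 ≤ 2 * ‖a - b‖ₑ ^ 2 + 2 * ‖b - c‖ₑ ^ 2 := by
  simp only [← ofReal_norm]
  rw [← ENNReal.ofReal_pow (norm_nonneg _), ← ENNReal.ofReal_pow (norm_nonneg _),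
    ← ENNReal.ofReal_pow (norm_nonneg _), ← ENNReal.ofReal_ofNat 2,
    ← ENNReal.ofReal_mul (by norm_num), ← ENNReal.ofReal_mul (by norm_num),
    ← ENNReal.ofReal_add (by positivity) (by positivity)]
  refine ENNReal.ofReal_le_ofReal ?_
  simp only [Real.norm_eq_abs, sq_abs]
  nlinarith [sq_nonneg (a - b - (b - c))]

theorem osc_comm {d : ℕ} {P : E d → ℝ} (hP : Measurable P) (A B : Set (E d)) :
    osc P A B = osc P B A := by
  unfold osc
  rw [lintegral_lintegral_swap]
  · simp only [enorm_sub_rev]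
  · have : Measurable (Function.uncurry fun x y : E d => ‖P x - P y‖ₑ ^ 2) := by
      unfold Function.uncurry; fun_prop
    exact this.aemeasurable

/-- An intermediate point of `B` is inserted between the points of `A` and `C`, and the resulting
inequality is integrated over `B`. -/
theorem osc_mul_le {d : ℕ} {P : E d → ℝ} (hP : Measurable P) (A B C : Set (E d)) :
    osc P A C * volume B ≤ 2 * (volume C * osc P A B + volume A * osc P B C) := by
  have m2 : Measurable fun z : E d × E d => ‖P z.1 - P z.2‖ₑ ^ 2 := by fun_prop
  have m2' : Measurable fun z : E d × E d => ‖P z.2 - P z.1‖ₑ ^ 2 := by fun_prop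
  calc osc P A C * volume B
      = ∫⁻ x in A, ∫⁻ z in C, ∫⁻ _ in B, ‖P x - P z‖ₑ ^ 2 := by
        simp only [setLIntegral_const]
        unfold osc
        rw [← lintegral_mul_const _ m2.lintegral_prod_right']
        refine lintegral_congr fun x => ?_
        rw [lintegral_mul_const _ (by fun_prop)]
    _ ≤ ∫⁻ x in A, ∫⁻ z in C, ∫⁻ y in B, (2 * ‖P x - P y‖ₑ ^ 2 + 2 * ‖P y - P z‖ₑ ^ 2) :=
        lintegral_mono fun x => lintegral_mono fun z => lintegral_mono fun y =>
          enorm_sub_sq_le _ _ _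
    _ = ∫⁻ x in A, (2 * (volume C * ∫⁻ y in B, ‖P x - P y‖ₑ ^ 2) + 2 * osc P C B) := by
        refine lintegral_congr fun x => ?_
        have : ∀ z, ∫⁻ y in B, (2 * ‖P x - P y‖ₑ ^ 2 + 2 * ‖P y - P z‖ₑ ^ 2)
            = 2 * (∫⁻ y in B, ‖P x - P y‖ₑ ^ 2) + 2 * ∫⁻ y in B, ‖P z - P y‖ₑ ^ 2 := by
          intro z
          rw [lintegral_add_left (by fun_prop), lintegral_const_mul _ (by fun_prop),
            lintegral_const_mul _ (by fun_prop)]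
          simp only [enorm_sub_rev (P z)]
        simp only [this]
        rw [lintegral_add_left measurable_const, setLIntegral_const,
          lintegral_const_mul _ m2.lintegral_prod_right']
        unfold osc
        ring
    _ = _ := by
        rw [lintegral_add_right _ measurable_const, setLIntegral_const, osc_comm hP C B,
          lintegral_const_mul _ (m2.lintegral_prod_right'.const_mul _),
          lintegral_const_mul _ m2.lintegral_prod_right']
        unfold osc
        ring

theorem Controls.symm {d : ℕ} {O A B : Set (E d)} (h : Controls O A B) : Controls O B A := by
  obtain ⟨C, hC, h⟩ := h
  exact ⟨C, hC, fun P G hPG => by rw [osc_comm hPG.measurable_fun]; exact h P G hPG⟩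

theorem Controls.mono {d : ℕ} {O A B A' B' : Set (E d)} (h : Controls O A B) (hA : A' ⊆ A)
    (hB : B' ⊆ B) : Controls O A' B' := by
  obtain ⟨C, hC, h⟩ := h
  refine ⟨C, hC, fun P G hPG => le_trans ?_ (h P G hPG)⟩
  exact (lintegral_mono_set hA).trans (lintegral_mono fun x => lintegral_mono_set hB)

/-- The average over the intermediate set costs a division by its volume, so that set must not be
null. -/
theorem Controls.trans {d : ℕ} {O A B C : Set (E d)} (h : Controls O A B) (h' : Controls O B C)
    (hA : volume A ≠ ⊤) (hB : volume B ≠ 0) (hB' : volume B ≠ ⊤) (hC : volume C ≠ ⊤) :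
    Controls O A C := by
  obtain ⟨K, hK, h⟩ := h
  obtain ⟨K', hK', h'⟩ := h'
  refine ⟨2 * (volume C * K + volume A * K') * (volume B)⁻¹, ?_, fun P G hPG => ?_⟩
  · have := ENNReal.inv_ne_top.2 hB
    finiteness
  · have h1 := osc_mul_le hPG.measurable_fun A B C
    calc osc P A C = osc P A C * volume B * (volume B)⁻¹ := by
          rw [mul_assoc, ENNReal.mul_inv_cancel hB hB', mul_one]
      _ ≤ 2 * (volume C * (K * ∫⁻ x, ‖G x‖ₑ ^ 2) + volume A * (K' * ∫⁻ x, ‖G x‖ₑ ^ 2))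
          * (volume B)⁻¹ := by
          gcongr ?_ * _
          refine h1.trans ?_
          gcongr
          · exact h P G hPG
          · exact h' P G hPG
      _ = _ := by ring

/-- With y = x + w, the oscillation becomes an integral over w of translation differences. Convexity
keeps the segments in the ball, and only |w| < 2r contributes. -/
theorem controls_ball {d : ℕ} {O : Set (E d)} {c : E d} {r : ℝ}
    (hO : Metric.ball c r ⊆ O) : Controls O (Metric.ball c r) (Metric.ball c r) := by
  set B := Metric.ball c r
  refine ⟨ENNReal.ofReal (2 * r) ^ 2 * volume (Metric.ball (0 : E d) (2 * r)), ?_,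
    fun P G hPG => ?_⟩
  · have := (measure_ball_lt_top (μ := volume) (x := (0 : E d)) (r := 2 * r)).ne
    finiteness
  have hm := hPG.measurable_fun
  have hBm : MeasurableSet B := Metric.isOpen_ball.measurableSet
  set F : E d → E d → ℝ≥0∞ := fun x w =>
    B.indicator 1 x * (B.indicator 1 (x + w) * ‖P (x + w) - P x‖ₑ ^ 2)
  have h1 : osc P B B = ∫⁻ x, ∫⁻ w, F x w := by
    unfold osc
    rw [← lintegral_indicator hBm]
    refine lintegral_congr fun x => ?_
    by_cases hx : x ∈ B
    · simp only [Set.indicator_of_mem hx, F, Pi.one_apply, one_mul]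
      rw [← lintegral_indicator hBm, ← lintegral_add_left_eq_self _ x]
      refine lintegral_congr fun w => ?_
      by_cases hw : x + w ∈ B
      · simp [hw, enorm_sub_rev (P x)]
      · simp [hw]
    · simp [hx, F]
  have hF : Measurable (Function.uncurry F) := by
    have hi : Measurable (B.indicator (1 : E d → ℝ≥0∞)) := measurable_one.indicator hBm
    unfold Function.uncurry
    simp only [F]
    fun_prop
  rw [h1, lintegral_lintegral_swap hF.aemeasurable]
  calc ∫⁻ w, ∫⁻ x, F x w
      ≤ ∫⁻ w, (Metric.ball (0 : E d) (2 * r)).indicator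
          (fun _ => ENNReal.ofReal (2 * r) ^ 2 * ∫⁻ x, ‖G x‖ₑ ^ 2) w := by
        refine lintegral_mono fun w => ?_
        by_cases hw : w ∈ Metric.ball (0 : E d) (2 * r)
        · rw [Set.indicator_of_mem hw]
          set A := B ∩ (fun x => x + w) ⁻¹' B
          have hA : IsOpen A := Metric.isOpen_ball.inter
            (Metric.isOpen_ball.preimage (continuous_id.add continuous_const))
          have e : ∫⁻ x, F x w = ∫⁻ x in A, ‖P (x + w) - P x‖ₑ ^ 2 := by
            rw [← lintegral_indicator hA.measurableSet]
            refine lintegral_congr fun x => ?_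
            by_cases h1 : x ∈ B <;> by_cases h2 : x + w ∈ B <;> simp [F, A, h1, h2]
          rw [e]
          refine (hPG.lintegral_shift_le hA w fun x hx t ht => hO ?_).trans ?_
          · exact (convex_ball c r).add_smul_mem hx.1 hx.2 ht
          · gcongr
            rw [← ofReal_norm]
            exact ENNReal.ofReal_le_ofReal (by simpa using (mem_ball_zero_iff.1 hw).le)
        · rw [Set.indicator_of_notMem hw]
          have : ∀ x, F x w = 0 := by
            intro x
            by_contra hne
            have h1 : x ∈ B := by by_contra h; simp [F, h] at hne
            have h2 : x + w ∈ B := by by_contra h; simp [F, h] at hne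
            refine hw (mem_ball_zero_iff.2 ?_)
            have h3 : dist (x + w) x < r + r :=
              (dist_triangle_right _ _ c).trans_lt (add_lt_add h2 h1)
            rw [dist_eq_norm, add_sub_cancel_left] at h3
            linarith
          simp [this]
    _ = _ := by
        rw [lintegral_indicator Metric.isOpen_ball.measurableSet, setLIntegral_const]
        ring

/-- P(x) is compared with P(x + w) by the translation estimate, and P(x + w) with P(y) inside `B`,
where the oscillation is already controlled. -/
theorem controls_of_shift {d : ℕ} {O D B : Set (E d)} (hD : IsOpen D) (w : E d)
    (hDw : ∀ x ∈ D, ∀ t ∈ Set.Icc (0 : ℝ) 1, x + t • w ∈ O) (hDB : ∀ x ∈ D, x + w ∈ B)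
    (hBm : MeasurableSet B) (hBB : Controls O B B)
    (hvB : volume B ≠ ⊤) : Controls O D B := by
  obtain ⟨K, hK, h⟩ := hBB
  refine ⟨2 * (volume B * ‖w‖ₑ ^ 2 + K), by finiteness, fun P G hPG => ?_⟩
  have hm := hPG.measurable_fun
  have m2 : Measurable fun z : E d × E d => ‖P z.1 - P z.2‖ₑ ^ 2 := by fun_prop
  have m1 : Measurable fun x : E d => ∫⁻ y in B, ‖P x - P y‖ₑ ^ 2 := m2.lintegral_prod_right'
  have m1w : Measurable fun x : E d => ∫⁻ y in B, ‖P (x + w) - P y‖ₑ ^ 2 :=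
    m1.comp (measurable_add_const w)
  have hs : ∫⁻ x in D, ∫⁻ y in B, ‖P (x + w) - P y‖ₑ ^ 2 ≤ osc P B B := by
    unfold osc
    rw [← lintegral_indicator hD.measurableSet, ← lintegral_indicator hBm,
      ← lintegral_add_right_eq_self (B.indicator _) w]
    refine lintegral_mono fun x => ?_
    by_cases hx : x ∈ D
    · simp [hx, hDB x hx]
    · simp [hx]
  calc osc P D B
      ≤ ∫⁻ x in D, ∫⁻ y in B, (2 * ‖P (x + w) - P x‖ₑ ^ 2 + 2 * ‖P (x + w) - P y‖ₑ ^ 2) :=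
        lintegral_mono fun x => lintegral_mono fun y => by
          rw [enorm_sub_rev (P (x + w)) (P x)]; exact enorm_sub_sq_le _ _ _
    _ = 2 * (volume B * ∫⁻ x in D, ‖P (x + w) - P x‖ₑ ^ 2)
        + 2 * ∫⁻ x in D, ∫⁻ y in B, ‖P (x + w) - P y‖ₑ ^ 2 := by
        have : ∀ x, ∫⁻ y in B, (2 * ‖P (x + w) - P x‖ₑ ^ 2 + 2 * ‖P (x + w) - P y‖ₑ ^ 2)
            = (2 * volume B) * ‖P (x + w) - P x‖ₑ ^ 2
              + 2 * ∫⁻ y in B, ‖P (x + w) - P y‖ₑ ^ 2 := by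
          intro x
          rw [lintegral_add_left measurable_const, setLIntegral_const,
            lintegral_const_mul _ (by fun_prop)]
          ring
        simp only [this]
        rw [lintegral_add_left (by fun_prop), lintegral_const_mul _ (by fun_prop),
          lintegral_const_mul _ m1w, mul_assoc]
    _ ≤ 2 * (volume B * (‖w‖ₑ ^ 2 * ∫⁻ x, ‖G x‖ₑ ^ 2)) + 2 * (K * ∫⁻ x, ‖G x‖ₑ ^ 2) := by
        gcongr
        · exact hPG.lintegral_shift_le hD w hDw
        · exact hs.trans (h P G hPG)
    _ = _ := by ring

theorem Controls.union_left {d : ℕ} {O A A' B : Set (E d)} (h : Controls O A B)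
    (h' : Controls O A' B) : Controls O (A ∪ A') B := by
  obtain ⟨K, hK, h⟩ := h
  obtain ⟨K', hK', h'⟩ := h'
  refine ⟨K + K', by finiteness, fun P G hPG => (lintegral_union_le _ _ _).trans ?_⟩
  rw [add_mul]
  exact add_le_add (h P G hPG) (h' P G hPG)

theorem Controls.biUnion_left {d : ℕ} {ι : Type*} {O B : Set (E d)} {A : ι → Set (E d)}
    (s : Finset ι) (h : ∀ i ∈ s, Controls O (A i) B) : Controls O (⋃ i ∈ s, A i) B := by
  classical
  induction s using Finset.induction_on with
  | empty => exact ⟨0, by simp, fun P G _ => by simp [osc]⟩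
  | insert i s _ ih =>
    rw [Finset.set_biUnion_insert]
    exact (h i (Finset.mem_insert_self i s)).union_left
      (ih fun j hj => h j (Finset.mem_insert_of_mem hj))

/-! ### The geometry of Lipschitz domains and the global oscillation bound -/

/-- Near a boundary point, moving against the graph direction `e` leads into the interior, so one
translation carries a whole boundary piece into an interior ball. Membership in the closure of the
interior later ensures that overlaps of pieces have positive volume. -/
theorem HasLipschitzBoundary.exists_nhds_controls {d : ℕ} {Ω : Set (E d)}
    (hL : HasLipschitzBoundary Ω) {x : E d} (hx : x ∈ Ω) :
    ∃ (N : Set (E d)) (c : E d) (r : ℝ), IsOpen N ∧ x ∈ N ∧ x ∈ closure (interior Ω) ∧ 0 < r ∧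
      Metric.ball c r ⊆ interior Ω ∧ Controls (interior Ω) (N ∩ interior Ω) (Metric.ball c r) := by
  by_cases hxi : x ∈ interior Ω
  · obtain ⟨r, hr, hb⟩ := Metric.isOpen_iff.1 isOpen_interior x hxi
    exact ⟨Metric.ball x r, x, r, Metric.isOpen_ball, Metric.mem_ball_self hr,
      subset_closure hxi, hr, hb,
      (controls_ball hb).mono Set.inter_subset_left subset_rfl⟩
  obtain ⟨e, γ, K, W, he, hγ, hγe, hW, hxW, hΩW⟩ := hL x ⟨subset_closure hx, hxi⟩
  have hbelow : ∀ y ∈ W, inner ℝ y e < γ y → y ∈ interior Ω := by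
    intro y hyW hy
    have hopen : IsOpen (W ∩ {y | inner ℝ y e < γ y}) :=
      hW.inter (isOpen_lt (by fun_prop) hγ.continuous)
    refine mem_interior.2 ⟨_, fun z hz => ?_, hopen, ⟨hyW, hy⟩⟩
    have : z ∈ Ω ∩ W := by rw [hΩW]; exact ⟨hz.1, hz.2.le⟩
    exact this.1
  have hee : inner ℝ e e = (1 : ℝ) := by rw [real_inner_self_eq_norm_sq, he]; norm_num
  -- Moving by `-t • e` leaves `γ` unchanged and lowers the height by `t`, so the point lands
  -- strictly below the graph.
  have hdown : ∀ y ∈ Ω, y ∈ W → ∀ t : ℝ, 0 < t → y - t • e ∈ W → y - t • e ∈ interior Ω := by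
    intro y hy hyW t ht hytW
    refine hbelow _ hytW ?_
    have h1 : y ∈ {y | y ∈ W ∧ inner ℝ y e ≤ γ y} := hΩW ▸ ⟨hy, hyW⟩
    have h2 : γ (y - t • e) = γ y := by
      have := hγe y (-t); rwa [neg_smul, ← sub_eq_add_neg] at this
    rw [h2, inner_sub_left, inner_smul_left, hee]
    have := h1.2
    simp only [conj_trivial]
    linarith
  obtain ⟨ε, hε, hball⟩ := Metric.isOpen_iff.1 hW x hxW
  have hnorm : ∀ t : ℝ, ‖t • e‖ = |t| := fun t => by rw [norm_smul, he, mul_one, Real.norm_eq_abs]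
  have hmemW : ∀ y t, dist y x < ε / 2 → |t| < ε / 2 → y - t • e ∈ W := by
    intro y t hy ht
    refine hball ?_
    rw [Metric.mem_ball, dist_eq_norm]
    calc ‖y - t • e - x‖ = ‖(y - x) - t • e‖ := by congr 1; abel
      _ ≤ ‖y - x‖ + ‖t • e‖ := norm_sub_le _ _
      _ < ε := by rw [hnorm, ← dist_eq_norm]; linarith
  -- A point within ε/2 of `x`, moved by less than ε/2, stays in `W`. The step ε/4 and a radius of
  -- at most ε/4 leave room for both.
  set h := ε / 4 with hh
  have hc : x - h • e ∈ interior Ω := hdown x hx hxW h (by positivity)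
    (hmemW x h (by simpa using hε) (by rw [abs_of_pos (by positivity)]; linarith))
  obtain ⟨r, hr, hb⟩ := Metric.isOpen_iff.1 isOpen_interior _ hc
  set δ := min r (ε / 4) with hδ
  have hδ0 : 0 < δ := by positivity
  have hb' : Metric.ball (x - h • e) δ ⊆ interior Ω :=
    (Metric.ball_subset_ball (min_le_left _ _)).trans hb
  refine ⟨Metric.ball x δ, x - h • e, δ, Metric.isOpen_ball, Metric.mem_ball_self hδ0, ?_, hδ0,
    hb', ?_⟩
  · have ht : Tendsto (fun t : ℝ => x - t • e) (𝓝[>] 0) (𝓝 x) := by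
      have : Continuous fun t : ℝ => x - t • e := by fun_prop
      simpa using (this.tendsto 0).mono_left nhdsWithin_le_nhds
    refine mem_closure_of_tendsto ht ?_
    filter_upwards [Ioo_mem_nhdsGT (show (0 : ℝ) < ε / 2 by positivity)] with t ht
    exact hdown x hx hxW t ht.1 (hmemW x t (by simpa using hε) (by rw [abs_of_pos ht.1]; exact ht.2))
  · refine controls_of_shift (Metric.isOpen_ball.inter isOpen_interior) (-(h • e)) ?_ ?_
      Metric.isOpen_ball.measurableSet (controls_ball hb') measure_ball_lt_top.ne
    · intro y hy t ht
      -- At time 0 the point has not moved below the graph; it is interior by assumption.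
      rcases ht.1.eq_or_lt with rfl | ht0
      · simpa using hy.2
      have hyx : dist y x < ε / 2 := (Metric.mem_ball.1 hy.1).trans_le
        ((min_le_right _ _).trans (by linarith))
      have : y + t • -(h • e) = y - (t * h) • e := by rw [smul_neg, smul_smul, sub_eq_add_neg]
      rw [this]
      have hth : 0 < t * h := by positivity
      have hth' : t * h ≤ h := mul_le_of_le_one_left (by positivity) ht.2
      refine hdown y (interior_subset hy.2) ?_ _ hth (hmemW y _ hyx ?_)
      · simpa using hmemW y 0 hyx (by simpa using hε)
      · rw [abs_of_pos hth]; linarith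
    · intro y hy
      have := Metric.mem_ball.1 hy.1
      rw [Metric.mem_ball, dist_eq_norm]
      rw [dist_eq_norm] at this
      convert this using 2
      abel

/-- The Poincaré inequality on a connected compact set with Lipschitz boundary, in terms of
oscillations. -/
theorem controls_interior {d : ℕ} {Ω : Set (E d)} (hΩ : IsCompact Ω)
    (hL : HasLipschitzBoundary Ω) (hconn : IsPreconnected Ω) :
    Controls (interior Ω) (interior Ω) (interior Ω) := by
  have hfin : ∀ A : Set (E d), A ⊆ interior Ω → volume A ≠ ⊤ := fun A hA =>
    ((measure_mono (hA.trans interior_subset)).trans_lt hΩ.measure_lt_top).ne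
  have hloc := fun (x : Ω) => hL.exists_nhds_controls x.2
  choose N c r hN hxN hcl hr hball hctrl using hloc
  have hpos : ∀ x : Ω, volume (Metric.ball (c x) (r x)) ≠ 0 := fun x =>
    (Metric.measure_ball_pos _ _ (hr x)).ne'
  have hballs : ∀ x y : Ω, Controls (interior Ω) (Metric.ball (c x) (r x))
      (Metric.ball (c y) (r y)) := by
    have hpre : PreconnectedSpace Ω := isPreconnected_iff_preconnectedSpace.1 hconn
    intro x y
    -- On a preconnected space, a symmetric and transitive relation that holds between each point
    -- and all nearby points holds everywhere. Only Ω itself is known to be connected, so the chain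
    -- runs through Ω and not through its interior.
    refine hpre.isPreconnected_univ.induction₂
      (fun x y : Ω => Controls (interior Ω) (Metric.ball (c x) (r x)) (Metric.ball (c y) (r y)))
      ?_ ?_ ?_ (Set.mem_univ x) (Set.mem_univ y)
    · intro x _
      rw [nhdsWithin_univ]
      filter_upwards [((hN x).preimage continuous_subtype_val).mem_nhds (hxN x)] with y hy
      -- The set `N x ∩ N y` is a neighborhood of `y`, which is a limit of interior points; hence
      -- the overlap is open and nonempty.
      have hne : volume (N x ∩ N y ∩ interior Ω) ≠ 0 := by
        refine (((hN x).inter (hN y)).inter isOpen_interior).measure_ne_zero volume ?_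
        exact mem_closure_iff.1 (hcl y) _ ((hN x).inter (hN y)) ⟨hy, hxN y⟩
      have h1 : Controls (interior Ω) (Metric.ball (c x) (r x)) (N x ∩ N y ∩ interior Ω) :=
        ((hctrl x).mono (Set.inter_subset_inter_left _ Set.inter_subset_left) subset_rfl).symm
      have h2 : Controls (interior Ω) (N x ∩ N y ∩ interior Ω) (Metric.ball (c y) (r y)) :=
        (hctrl y).mono (Set.inter_subset_inter_left _ Set.inter_subset_right) subset_rfl
      exact h1.trans h2 (hfin _ (hball x)) hne (hfin _ Set.inter_subset_right) (hfin _ (hball y))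
    · intro x y z _ _ _ hxy hyz
      exact hxy.trans hyz (hfin _ (hball x)) (hpos y) (hfin _ (hball y)) (hfin _ (hball z))
    · intro x y _ _ h
      exact h.symm
  have hpieces : ∀ x y : Ω, Controls (interior Ω) (N x ∩ interior Ω) (N y ∩ interior Ω) :=
    fun x y => ((hctrl x).trans (hballs x y) (hfin _ Set.inter_subset_right) (hpos x)
      (hfin _ (hball x)) (hfin _ (hball y))).trans (hctrl y).symm (hfin _ Set.inter_subset_right)
      (hpos y) (hfin _ (hball y)) (hfin _ Set.inter_subset_right)
  obtain ⟨s, hs⟩ := hΩ.elim_finite_subcover N hN fun x hx => Set.mem_iUnion.2 ⟨⟨x, hx⟩, hxN _⟩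
  have hcover : interior Ω ⊆ ⋃ x ∈ s, N x ∩ interior Ω := by
    intro x hx
    obtain ⟨i, hi, hxi⟩ := Set.mem_iUnion₂.1 (hs (interior_subset hx))
    exact Set.mem_iUnion₂.2 ⟨i, hi, hxi, hx⟩
  refine Controls.mono ?_ hcover hcover
  exact Controls.biUnion_left s fun x _ =>
    (Controls.biUnion_left s fun y _ => hpieces y x).symm

/-- A compact set with Lipschitz boundary has a null boundary. -/
theorem HasLipschitzBoundary.volume_frontier {d : ℕ} {Ω : Set (E d)} (hΩ : IsClosed Ω)
    (hL : HasLipschitzBoundary Ω) : volume (frontier Ω) = 0 := by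
  refine measure_null_of_locally_null _ fun x hx => ?_
  obtain ⟨e, γ, K, W, he, hγ, hγe, hW, hxW, hΩW⟩ := hL x hx
  -- The vertical translates of the graph are uncountably many disjoint sets of equal volume. In a
  -- σ-finite measure they must be null.
  set A : ℝ → Set (E d) := fun t => {y | inner ℝ y e = γ y + t} with hA
  have hAm : ∀ t, MeasurableSet (A t) := fun t =>
    (isClosed_eq (by fun_prop) (hγ.continuous.add continuous_const)).measurableSet
  have hdisj : Pairwise (Function.onFun Disjoint A) := by
    intro s t hst
    refine Set.disjoint_left.2 fun y hys hyt => hst ?_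
    simp only [hA, Set.mem_ofPred_eq] at hys hyt
    linarith
  have hAt : ∀ t, volume (A t) = volume (A 0) := by
    intro t
    have : (fun y => y + t • e) ⁻¹' A t = A 0 := by
      ext y
      simp [hA, hγe, inner_add_left, inner_smul_left, he]
    rw [← this, measure_preimage_add_right]
  have hnull : volume (A 0) = 0 := by
    by_contra hne
    have hc := Measure.countable_meas_pos_of_disjoint_iUnion (μ := volume) hAm hdisj
    have : {t | 0 < volume (A t)} = Set.univ := by
      ext t; simp [hAt t, pos_iff_ne_zero, hne]
    rw [this] at hc
    exact Set.not_countable_univ hc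
  refine ⟨W ∩ frontier Ω, Filter.inter_mem (mem_nhdsWithin_of_mem_nhds (hW.mem_nhds hxW))
    self_mem_nhdsWithin, measure_mono_null ?_ hnull⟩
  rintro y ⟨hyW, hy⟩
  have h1 : y ∈ {y | y ∈ W ∧ inner ℝ y e ≤ γ y} := hΩW ▸ ⟨hΩ.frontier_subset hy, hyW⟩
  rcases h1.2.lt_or_eq with hlt | heq
  · refine absurd (mem_interior.2 ⟨W ∩ {y | inner ℝ y e < γ y}, fun z hz => ?_,
      hW.inter (isOpen_lt (by fun_prop) hγ.continuous), hyW, hlt⟩) hy.2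
    have : z ∈ Ω ∩ W := by rw [hΩW]; exact ⟨hz.1, le_of_lt hz.2⟩
    exact this.1
  · simpa [hA] using heq

/-! ### The Poincaré inequality and uniqueness of weak gradients -/

theorem eLpNorm_two_sq {α F : Type*} [MeasurableSpace α] [NormedAddCommGroup F] {μ : Measure α}
    (f : α → F) : eLpNorm f 2 μ ^ 2 = ∫⁻ x, ‖f x‖ₑ ^ 2 ∂μ := by
  rw [eLpNorm_eq_lintegral_rpow_enorm_toReal (by simp) (by simp), ← ENNReal.rpow_natCast,
    ← ENNReal.rpow_mul]
  norm_num

theorem setIntegral_eq_of_forall_eq_zero {α : Type*} [MeasurableSpace α] {μ : Measure α}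
    {O : Set α} {f g : α → ℝ} (hfg : f =ᵐ[μ.restrict O] g)
    (hg : ∀ x, x ∉ O → g x = 0) : ∫ x, g x ∂μ = ∫ x in O, f x ∂μ := by
  rw [← setIntegral_eq_integral_of_forall_compl_eq_zero hg]
  exact integral_congr_ae hfg.symm

/-- The representatives of a Sobolev function and of its gradient that vanish outside the domain. -/
theorem IsWeakGradient.exists_h1Pair {d : ℕ} {O : Set (E d)} (hO : IsOpen O) {p : E d → ℝ}
    {g : E d → E d} (h : IsWeakGradient O p g) (hp : IntegrableOn p O) (hg : IntegrableOn g O) :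
    ∃ P G, H1Pair O P G ∧ P =ᵐ[volume.restrict O] p ∧
      ∫⁻ x, ‖G x‖ₑ ^ 2 = ∫⁻ x in O, ‖g x‖ₑ ^ 2 := by
  have hm := hO.measurableSet
  -- Extension by zero need not be weakly differentiable across the boundary. This is harmless,
  -- since only test functions supported in `O` are used.
  set P := O.indicator (hp.1.mk p)
  set G := O.indicator (hg.1.mk g)
  have eP : p =ᵐ[volume.restrict O] P := hp.1.ae_eq_mk.trans (indicator_ae_eq_restrict hm).symm
  have eG : g =ᵐ[volume.restrict O] G := hg.1.ae_eq_mk.trans (indicator_ae_eq_restrict hm).symm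
  refine ⟨P, G, ⟨hp.1.stronglyMeasurable_mk.measurable.indicator hm,
    hg.1.stronglyMeasurable_mk.measurable.indicator hm, ?_, ?_, ?_⟩, eP.symm, ?_⟩
  · exact (integrable_indicator_iff hm).2 (Integrable.congr hp hp.1.ae_eq_mk)
  · exact (integrable_indicator_iff hm).2 (Integrable.congr hg hg.1.ae_eq_mk)
  · intro φ hφ hφc hφO v
    rw [setIntegral_eq_of_forall_eq_zero (f := fun x => p x * fderiv ℝ φ x v)
      (eP.mono fun x hx => by simp only [hx]) (fun x hx => by simp [P, hx]), h.2.2 φ hφ hφc hφO v,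
      setIntegral_eq_of_forall_eq_zero (f := fun x => φ x * inner ℝ (g x) v)
      (eG.mono fun x hx => by simp only [hx]) (fun x hx => by simp [G, hx])]
  · have : ∀ x, ‖G x‖ₑ ^ 2 = O.indicator (fun x => ‖G x‖ₑ ^ 2) x := by
      intro x
      by_cases hx : x ∈ O <;> simp [hx, G]
    rw [lintegral_congr this, lintegral_indicator hm]
    exact lintegral_congr_ae (eG.mono fun x hx => by simp only [hx])

/-- The Poincaré inequality for functions with mean zero. -/
theorem exists_poincare {d : ℕ} {O : Set (E d)} (hO : IsOpen O) (hvol : volume O = 1)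
    (hctrl : Controls O O O) :
    ∃ C : ℝ, 0 ≤ C ∧ ∀ p g, MemLp p 2 (volume.restrict O) → MemLp g 2 (volume.restrict O) →
      IsWeakGradient O p g → ∫ x in O, p x = 0 →
      eLpNorm p 2 (volume.restrict O) ≤ ENNReal.ofReal C * eLpNorm g 2 (volume.restrict O) := by
  obtain ⟨K, hK, h⟩ := hctrl
  have : IsProbabilityMeasure (volume.restrict O) := ⟨by simp [hvol]⟩
  refine ⟨√K.toReal, Real.sqrt_nonneg _, fun p g hp hg hpg hmean => ?_⟩
  obtain ⟨P, G, hPG, hP, hG⟩ := hpg.exists_h1Pair hO (hp.integrable (by norm_num))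
    (hg.integrable (by norm_num))
  have hPO : Integrable P (volume.restrict O) := hPG.integrable_fun.integrableOn
  have hm := hPG.measurable_fun
  have hP0 : ∫ x in O, P x = 0 := by rw [integral_congr_ae hP, hmean]
  -- Mean zero and total mass one make P(x) the average of P(x) - P(y) over y.
  have hpt : ∀ x, ‖P x‖ₑ ^ 2 ≤ ∫⁻ y in O, ‖P x - P y‖ₑ ^ 2 := by
    intro x
    have e : P x = ∫ y in O, (P x - P y) := by
      rw [integral_sub (integrable_const _) hPO, hP0]; simp [Measure.real]
    calc ‖P x‖ₑ ^ 2 ≤ (∫⁻ y in O, ‖P x - P y‖ₑ) ^ 2 := by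
          refine pow_le_pow_left' ?_ 2
          conv_lhs => rw [e]
          exact enorm_integral_le_lintegral_enorm _
      _ ≤ _ := sq_lintegral_le (by fun_prop)
  have hsq : eLpNorm p 2 (volume.restrict O) ^ 2
      ≤ (ENNReal.ofReal √K.toReal * eLpNorm g 2 (volume.restrict O)) ^ 2 := by
    rw [mul_pow, ← ENNReal.ofReal_pow (Real.sqrt_nonneg _), Real.sq_sqrt ENNReal.toReal_nonneg,
      ENNReal.ofReal_toReal hK, eLpNorm_two_sq g, ← hG, ← eLpNorm_congr_ae hP, eLpNorm_two_sq P]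
    exact (lintegral_mono hpt).trans (h P G hPG)
  exact (ENNReal.pow_le_pow_left_iff (by norm_num)).1 hsq

/-- The fundamental lemma of the calculus of variations, applied to the difference. It makes the
choice in `weakGradient` immaterial. -/
theorem IsWeakGradient.ae_eq {d : ℕ} {O : Set (E d)} (hO : IsOpen O) {p : E d → ℝ}
    {g g' : E d → E d} (h : IsWeakGradient O p g) (h' : IsWeakGradient O p g') :
    g =ᵐ[volume.restrict O] g' := by
  have hl : LocallyIntegrableOn (fun x => g x - g' x) O volume := h.2.1.sub h'.2.1
  have key := hO.ae_eq_zero_of_integral_contDiff_smul_eq_zero hl ?_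
  · rw [Filter.EventuallyEq, ae_restrict_iff' hO.measurableSet]
    filter_upwards [key] with x hx hxO using sub_eq_zero.1 (hx hxO)
  intro φ hφ hφc hφO
  have hint : ∀ f : E d → E d, LocallyIntegrableOn f O volume →
      Integrable (fun x => φ x • f x) := by
    intro f hf
    have h1 : IntegrableOn f (tsupport φ) := hf.integrableOn_compact_subset hφO hφc
    obtain ⟨C, hC⟩ := hφc.exists_bound_of_continuous hφ.continuous
    have h2 : IntegrableOn (fun x => φ x • f x) (tsupport φ) :=
      Integrable.bdd_smul h1 C hφ.continuous.aestronglyMeasurable (Eventually.of_forall hC)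
    refine (integrableOn_iff_integrable_of_support_subset ?_).1 h2
    intro x hx
    refine subset_tsupport φ fun h0 => hx ?_
    simp [h0]
  have hz : ∀ f : E d → E d, ∀ v, ∫ x, φ x * inner ℝ (f x) v = ∫ x in O, φ x * inner ℝ (f x) v := by
    intro f v
    refine (setIntegral_eq_integral_of_forall_compl_eq_zero fun x hx => ?_).symm
    rw [image_eq_zero_of_notMem_tsupport fun h => hx (hφO h), zero_mul]
  have hvec : ∀ f : E d → E d, LocallyIntegrableOn f O volume → ∀ v,
      inner ℝ v (∫ x, φ x • f x) = ∫ x in O, φ x * inner ℝ (f x) v := by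
    intro f hf v
    rw [← integral_inner (hint f hf), ← hz]
    refine integral_congr_ae (Eventually.of_forall fun x => ?_)
    simp only [inner_smul_right, real_inner_comm]
  simp only [smul_sub]
  rw [integral_sub (hint g h.2.1) (hint g' h'.2.1), sub_eq_zero]
  refine ext_inner_left ℝ fun v => ?_
  rw [hvec g h.2.1, hvec g' h'.2.1]
  exact neg_injective ((h.2.2 φ hφ hφc hφO v).symm.trans (h'.2.2 φ hφ hφc hφO v))

theorem IsWeakGradient.weakGradient_ae_eq {d : ℕ} {O : Set (E d)} (hO : IsOpen O) {p : E d → ℝ}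
    {g : E d → E d} (h : IsWeakGradient O p g) :
    weakGradient O p =ᵐ[volume.restrict O] g := by
  have hex : ∃ g, IsWeakGradient O p g := ⟨g, h⟩
  rw [weakGradient, dif_pos hex]
  exact hex.choose_spec.ae_eq hO h

/-! ### Existence of maximizers -/

/-- A concave quadratic functional attains its maximum on a closed convex set on which the
quadratic part controls the norm. -/
theorem exists_isMaxOn_sub_sq {X Y : Type*} [NormedAddCommGroup X] [NormedSpace ℝ X]
    [CompleteSpace X] [NormedAddCommGroup Y] [InnerProductSpace ℝ Y] [CompleteSpace Y]
    {K : Set (X × Y)} (hKc : IsClosed K) (hKconv : Convex ℝ K) (hKne : K.Nonempty)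
    (l : X →L[ℝ] ℝ) {β C : ℝ} (hβ : 0 < β)
    (hC : ∀ k ∈ K, ∀ k' ∈ K, ‖k.1 - k'.1‖ ≤ C * ‖k.2 - k'.2‖) :
    ∃ k ∈ K, IsMaxOn (fun k => l k.1 - β * ‖k.2‖ ^ 2) K k := by
  set F : X × Y → ℝ := fun k => l k.1 - β * ‖k.2‖ ^ 2 with hF
  obtain ⟨k₀, hk₀⟩ := hKne
  have hbdd : BddAbove (F '' K) := by
    set M := ‖l‖ * |C|
    refine ⟨l k₀.1 + M * ‖k₀.2‖ + M ^ 2 / (4 * β), ?_⟩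
    rintro _ ⟨k, hk, rfl⟩
    have h1 : l k.1 - l k₀.1 ≤ M * (‖k.2‖ + ‖k₀.2‖) := by
      rw [← map_sub]
      calc l (k.1 - k₀.1) ≤ ‖l (k.1 - k₀.1)‖ := le_abs_self _
        _ ≤ ‖l‖ * ‖k.1 - k₀.1‖ := l.le_opNorm _
        _ ≤ ‖l‖ * (|C| * (‖k.2‖ + ‖k₀.2‖)) := by
            gcongr
            exact (hC k hk k₀ hk₀).trans (mul_le_mul (le_abs_self C) (norm_sub_le _ _)
              (norm_nonneg _) (abs_nonneg C))
        _ = _ := by ring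
    have h2 : M * ‖k.2‖ - β * ‖k.2‖ ^ 2 ≤ M ^ 2 / (4 * β) := by
      rw [le_div_iff₀ (by positivity)]
      nlinarith [sq_nonneg (M - 2 * β * ‖k.2‖)]
    simp only [hF]
    linarith
  set S := sSup (F '' K)
  have hle : ∀ k ∈ K, F k ≤ S := fun k hk => le_csSup hbdd ⟨k, hk, rfl⟩
  obtain ⟨y, -, hyS, hyK⟩ := exists_seq_tendsto_sSup (Set.Nonempty.image F ⟨k₀, hk₀⟩) hbdd
  choose k hk hky using hyK
  have hFk : Tendsto (fun n => F (k n)) atTop (𝓝 S) := by simpa only [hky] using hyS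
  -- By the parallelogram law, the value at the midpoint exceeds the mean of the two values by β/4
  -- times the squared distance of the second entries; and it is at most `S`.
  have hpar : ∀ n m, β * ‖(k n).2 - (k m).2‖ ^ 2 ≤ 2 * (S - F (k n)) + 2 * (S - F (k m)) := by
    intro n m
    have hmid := hle _ (hKconv (hk n) (hk m) (a := 1 / 2) (b := 1 / 2) (by norm_num) (by norm_num)
      (by norm_num))
    simp only [hF, Prod.fst_add, Prod.snd_add, Prod.smul_fst, Prod.smul_snd, map_add, map_smul,
      smul_eq_mul, ← smul_add, norm_smul] at hmid ⊢
    have hp := parallelogram_law_with_norm ℝ (k n).2 (k m).2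
    norm_num at hmid
    nlinarith
  have hc2 : CauchySeq fun n => (k n).2 := by
    refine Metric.cauchySeq_iff.2 fun ε hε => ?_
    have hev : ∀ᶠ n in atTop, S - β * ε ^ 2 / 4 < F (k n) :=
      hFk.eventually_const_lt (by have : 0 < β * ε ^ 2 / 4 := by positivity
                                  linarith)
    obtain ⟨N, hN⟩ := eventually_atTop.1 hev
    refine ⟨N, fun n hn m hm => ?_⟩
    rw [dist_eq_norm]
    refine lt_of_pow_lt_pow_left₀ 2 hε.le (lt_of_mul_lt_mul_left ?_ hβ.le)
    linarith [hpar n m, hN n hn, hN m hm]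
  have hc1 : CauchySeq fun n => (k n).1 := by
    refine Metric.cauchySeq_iff.2 fun ε hε => ?_
    -- The constant `C` may be zero or negative; `|C| + 1` is a positive substitute.
    obtain ⟨N, hN⟩ := Metric.cauchySeq_iff.1 hc2 (ε / (|C| + 1)) (by positivity)
    refine ⟨N, fun n hn m hm => ?_⟩
    have h1 := hN n hn m hm
    rw [dist_eq_norm, lt_div_iff₀ (by positivity)] at h1
    rw [dist_eq_norm]
    have h2 := hC _ (hk n) _ (hk m)
    nlinarith [le_abs_self C, norm_nonneg ((k n).2 - (k m).2)]
  obtain ⟨x, hx⟩ := cauchySeq_tendsto_of_complete hc1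
  obtain ⟨z, hz⟩ := cauchySeq_tendsto_of_complete hc2
  have hlim : Tendsto k atTop (𝓝 (x, z)) := hx.prodMk_nhds hz
  have hFc : Continuous F := by fun_prop
  have hmem : (x, z) ∈ K := hKc.mem_of_tendsto hlim (Eventually.of_forall hk)
  refine ⟨(x, z), hmem, fun k' hk' => ?_⟩
  have : F (x, z) = S := tendsto_nhds_unique ((hFc.tendsto _).comp hlim) hFk
  change F k' ≤ F (x, z)
  rw [this]
  exact hle k' hk'

/-! ### Sobolev densities as a closed convex set in a product of L² spaces -/

theorem integral_mul_eq_inner {α : Type*} [MeasurableSpace α] {μ : Measure α} {f p : α → ℝ}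
    (hf : MemLp f 2 μ) (hp : MemLp p 2 μ) :
    ∫ x, f x * p x ∂μ = inner ℝ (hf.toLp f) (hp.toLp p) := by
  rw [L2.inner_def]
  refine integral_congr_ae ?_
  filter_upwards [hf.coeFn_toLp, hp.coeFn_toLp] with x h1 h2
  rw [h1, h2]
  simp [mul_comm]

theorem integral_mul_inner_eq_inner {d : ℕ} {μ : Measure (E d)} {φ : E d → ℝ} {v : E d}
    {g : E d → E d} (hφ : MemLp (fun x => φ x • v) 2 μ) (hg : MemLp g 2 μ) :
    ∫ x, φ x * inner ℝ (g x) v ∂μ = inner ℝ (hφ.toLp _) (hg.toLp g) := by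
  rw [L2.inner_def]
  refine integral_congr_ae ?_
  filter_upwards [hφ.coeFn_toLp, hg.coeFn_toLp] with x h1 h2
  rw [h1, h2, inner_smul_left, real_inner_comm]
  simp

theorem memLp_fderiv_apply {d : ℕ} {φ : E d → ℝ} (hφ : ContDiff ℝ ∞ φ) (hc : HasCompactSupport φ)
    (v : E d) (O : Set (E d)) : MemLp (fun x => fderiv ℝ φ x v) 2 (volume.restrict O) := by
  have h1 : Continuous fun x => fderiv ℝ φ x v := by
    have := hφ.continuous_fderiv (by simp)
    fun_prop
  have h2 : HasCompactSupport fun x => fderiv ℝ φ x v := hc.fderiv_apply (𝕜 := ℝ) v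
  exact (h1.memLp_of_hasCompactSupport h2).restrict O

theorem memLp_smul_const {d : ℕ} {φ : E d → ℝ} (hφ : ContDiff ℝ ∞ φ) (hc : HasCompactSupport φ)
    (v : E d) (O : Set (E d)) : MemLp (fun x => φ x • v) 2 (volume.restrict O) := by
  have h1 : Continuous fun x => φ x • v := by
    have := hφ.continuous
    fun_prop
  exact (h1.memLp_of_hasCompactSupport hc.smul_right).restrict O

/-- Weak gradients among square integrable functions, in terms of inner products. -/
theorem isWeakGradient_iff_inner {d : ℕ} {O : Set (E d)} (hO : volume O ≠ ⊤) {p : E d → ℝ}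
    {g : E d → E d} (hp : MemLp p 2 (volume.restrict O)) (hg : MemLp g 2 (volume.restrict O)) :
    IsWeakGradient O p g ↔ ∀ (φ : E d → ℝ) (hφ : ContDiff ℝ ∞ φ) (hc : HasCompactSupport φ),
      tsupport φ ⊆ O → ∀ v : E d, inner ℝ ((memLp_fderiv_apply hφ hc v O).toLp _) (hp.toLp p)
        + inner ℝ ((memLp_smul_const hφ hc v O).toLp _) (hg.toLp g) = 0 := by
  have : IsFiniteMeasure (volume.restrict O) := ⟨by simpa using hO.lt_top⟩
  have hloc : LocallyIntegrableOn p O volume ∧ LocallyIntegrableOn g O volume :=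
    ⟨IntegrableOn.locallyIntegrableOn (hp.integrable (by norm_num)),
      IntegrableOn.locallyIntegrableOn (hg.integrable (by norm_num))⟩
  have key : ∀ (φ : E d → ℝ) (hφ : ContDiff ℝ ∞ φ) (hc : HasCompactSupport φ) (v : E d),
      (∫ x in O, p x * fderiv ℝ φ x v = - ∫ x in O, φ x * inner ℝ (g x) v) ↔
      inner ℝ ((memLp_fderiv_apply hφ hc v O).toLp _) (hp.toLp p)
        + inner ℝ ((memLp_smul_const hφ hc v O).toLp _) (hg.toLp g) = 0 := by
    intro φ hφ hc v
    rw [← integral_mul_eq_inner, ← integral_mul_inner_eq_inner, ← eq_neg_iff_add_eq_zero]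
    simp only [mul_comm]
  constructor
  · exact fun h φ hφ hc hs v => (key φ hφ hc v).1 (h.2.2 φ hφ hc hs v)
  · exact fun h => ⟨hloc.1, hloc.2, fun φ hφ hc hs v => (key φ hφ hc v).2 (h φ hφ hc hs v)⟩

/-- The pairs of square integrable functions whose second entry is a weak gradient of the first. -/
def sobolevSubmodule {d : ℕ} (O : Set (E d)) :
    Submodule ℝ (Lp ℝ 2 (volume.restrict O) × Lp (E d) 2 (volume.restrict O)) where
  carrier := {k | ∀ (φ : E d → ℝ) (hφ : ContDiff ℝ ∞ φ) (hc : HasCompactSupport φ),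
    tsupport φ ⊆ O → ∀ v : E d, inner ℝ ((memLp_fderiv_apply hφ hc v O).toLp _) k.1
      + inner ℝ ((memLp_smul_const hφ hc v O).toLp _) k.2 = 0}
  add_mem' := by
    intro k k' hk hk' φ hφ hc hs v
    have h1 := hk φ hφ hc hs v
    have h2 := hk' φ hφ hc hs v
    simp only [Prod.fst_add, Prod.snd_add, inner_add_right]
    linarith
  zero_mem' := by simp
  smul_mem' := by
    intro c k hk φ hφ hc hs v
    have h1 := hk φ hφ hc hs v
    simp only [Prod.smul_fst, Prod.smul_snd, inner_smul_right]
    linear_combination c * h1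

/-- Each test function and direction imposes one continuous linear equation on the pair. Closedness
in L² × L² plays the role of completeness of H¹. -/
theorem isClosed_sobolevSubmodule {d : ℕ} (O : Set (E d)) :
    IsClosed (sobolevSubmodule O).carrier := by
  have : (sobolevSubmodule O).carrier =
      ⋂ (φ : E d → ℝ) (hφ : ContDiff ℝ ∞ φ) (hc : HasCompactSupport φ) (_ : tsupport φ ⊆ O)
        (v : E d), {k | inner ℝ ((memLp_fderiv_apply hφ hc v O).toLp _) k.1
          + inner ℝ ((memLp_smul_const hφ hc v O).toLp _) k.2 = 0} := by
    ext k; simp [sobolevSubmodule]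
  rw [this]
  refine isClosed_iInter fun φ => isClosed_iInter fun hφ => isClosed_iInter fun hc =>
    isClosed_iInter fun _ => isClosed_iInter fun v => isClosed_eq ?_ continuous_const
  exact ((continuous_const.inner continuous_fst).add (continuous_const.inner continuous_snd))

theorem mem_sobolevSubmodule_toLp {d : ℕ} {O : Set (E d)} (hO : volume O ≠ ⊤) {p : E d → ℝ}
    {g : E d → E d} (hp : MemLp p 2 (volume.restrict O)) (hg : MemLp g 2 (volume.restrict O)) :
    (hp.toLp p, hg.toLp g) ∈ sobolevSubmodule O ↔ IsWeakGradient O p g :=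
  (isWeakGradient_iff_inner hO hp hg).symm

theorem mem_sobolevSubmodule {d : ℕ} {O : Set (E d)} (hO : volume O ≠ ⊤)
    (k : Lp ℝ 2 (volume.restrict O) × Lp (E d) 2 (volume.restrict O)) :
    k ∈ sobolevSubmodule O ↔ IsWeakGradient O k.1 k.2 := by
  rw [← mem_sobolevSubmodule_toLp hO (Lp.memLp k.1) (Lp.memLp k.2), Lp.toLp_coeFn, Lp.toLp_coeFn]

theorem isWeakGradient_const {d : ℕ} {O : Set (E d)} (hO : volume O ≠ ⊤) (c : ℝ) :
    IsWeakGradient O (fun _ => c) 0 := by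
  have : IsFiniteMeasure (volume.restrict O) := ⟨by simpa using hO.lt_top⟩
  refine ⟨IntegrableOn.locallyIntegrableOn (integrable_const c),
    IntegrableOn.locallyIntegrableOn (integrable_zero _ _ _), fun φ hφ hc hs v => ?_⟩
  have hz : ∫ x in O, c * fderiv ℝ φ x v = ∫ x, c * fderiv ℝ φ x v := by
    refine setIntegral_eq_integral_of_forall_compl_eq_zero fun x hx => ?_
    have : fderiv ℝ φ x = 0 := image_eq_zero_of_notMem_tsupport
      fun h => hx (hs (tsupport_fderiv_subset ℝ h))
    simp [this]
  have hd : Differentiable ℝ φ := hφ.differentiable (by simp)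
  have hi : Integrable φ := hφ.continuous.integrable_of_hasCompactSupport hc
  have hi' : Integrable fun x => fderiv ℝ φ x v := by
    have := hφ.continuous_fderiv (by simp)
    exact Continuous.integrable_of_hasCompactSupport (by fun_prop) (hc.fderiv_apply (𝕜 := ℝ) v)
  rw [hz, integral_mul_fderiv_eq_neg_fderiv_mul_of_integrable (f := fun _ => c) (g := φ)]
  · simp
  · simp
  · exact hi'.const_mul c
  · exact hi.const_mul c
  · exact fun x _ => differentiableAt_const c
  · exact fun x _ => hd x

/-- The constant function `1` in `L²`. -/
noncomputable def oneLp {d : ℕ} (O : Set (E d)) [IsFiniteMeasure (volume.restrict O)] :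
    Lp ℝ 2 (volume.restrict O) := (memLp_const (1 : ℝ)).toLp _

theorem inner_oneLp {d : ℕ} {O : Set (E d)} [IsFiniteMeasure (volume.restrict O)] {p : E d → ℝ}
    (hp : MemLp p 2 (volume.restrict O)) :
    inner ℝ (oneLp O) (hp.toLp p) = ∫ x in O, p x := by
  rw [oneLp, ← integral_mul_eq_inner]; simp

theorem norm_oneLp {d : ℕ} (O : Set (E d)) [IsProbabilityMeasure (volume.restrict O)] :
    ‖oneLp O‖ = 1 := by
  rw [oneLp, Lp.norm_toLp, eLpNorm_const _ (by norm_num) (NeZero.ne _)]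
  simp

/-- The square integrable densities with square integrable weak gradients. -/
def densityPairs {d : ℕ} (O : Set (E d)) [IsFiniteMeasure (volume.restrict O)] :
    Set (Lp ℝ 2 (volume.restrict O) × Lp (E d) 2 (volume.restrict O)) :=
  {k | 0 ≤ k.1} ∩ {k | inner ℝ (oneLp O) k.1 = 1} ∩ sobolevSubmodule O

theorem isClosed_densityPairs {d : ℕ} (O : Set (E d)) [IsFiniteMeasure (volume.restrict O)] :
    IsClosed (densityPairs O) :=
  ((isClosed_le continuous_const continuous_fst).inter
    (isClosed_eq (continuous_const.inner continuous_fst) continuous_const)).inter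
    (isClosed_sobolevSubmodule O)

theorem smul_nonneg_Lp {α : Type*} [MeasurableSpace α] {μ : Measure α} {p : ℝ≥0∞}
    {a : ℝ} (ha : 0 ≤ a) {f : Lp ℝ p μ} (hf : 0 ≤ f) : 0 ≤ a • f := by
  rw [← Lp.coeFn_nonneg] at hf ⊢
  filter_upwards [Lp.coeFn_smul a f, hf] with x h1 h2
  rw [h1]
  exact mul_nonneg ha h2

theorem convex_densityPairs {d : ℕ} (O : Set (E d)) [IsFiniteMeasure (volume.restrict O)] :
    Convex ℝ (densityPairs O) := by
  refine Convex.inter ?_ (sobolevSubmodule O).convex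
  rintro k ⟨h1, h2⟩ k' ⟨h1', h2'⟩ a b ha hb hab
  refine ⟨?_, ?_⟩
  · change 0 ≤ a • k.1 + b • k'.1
    exact add_nonneg (smul_nonneg_Lp ha h1) (smul_nonneg_Lp hb h1')
  · change inner ℝ (oneLp O) (a • k.1 + b • k'.1) = 1
    have e : inner ℝ (oneLp O) k.1 = 1 := h2
    have e' : inner ℝ (oneLp O) k'.1 = 1 := h2'
    rw [inner_add_right, inner_smul_right, inner_smul_right, e, e']
    simpa using hab

theorem toLp_mem_densityPairs {d : ℕ} {O : Set (E d)} [IsFiniteMeasure (volume.restrict O)]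
    (hO : volume O ≠ ⊤) {p : E d → ℝ} {g : E d → E d} (hp : MemLp p 2 (volume.restrict O))
    (hg : MemLp g 2 (volume.restrict O)) :
    (hp.toLp p, hg.toLp g) ∈ densityPairs O ↔
      (0 ≤ᵐ[volume.restrict O] p ∧ ∫ x in O, p x = 1) ∧ IsWeakGradient O p g := by
  refine and_congr (and_congr ?_ ?_) (mem_sobolevSubmodule_toLp hO hp hg)
  · change 0 ≤ hp.toLp p ↔ _
    rw [← Lp.coeFn_nonneg]
    exact eventually_congr (hp.coeFn_toLp.mono fun x hx => by rw [hx])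
  · change inner ℝ (oneLp O) (hp.toLp p) = 1 ↔ _
    rw [inner_oneLp]

theorem one_mem_densityPairs {d : ℕ} {O : Set (E d)} [IsProbabilityMeasure (volume.restrict O)]
    (hO : volume O ≠ ⊤) : (oneLp O, 0) ∈ densityPairs O := by
  have := (toLp_mem_densityPairs hO (memLp_const (1 : ℝ)) (MemLp.zero' (ε := E d))).2
    ⟨⟨Eventually.of_forall fun _ => zero_le_one, by simp⟩, isWeakGradient_const hO 1⟩
  exact this

/-- Two densities have the same integral, so their difference has mean zero and the Poincaré
inequality applies. -/
theorem norm_sub_le_of_mem_densityPairs {d : ℕ} {O : Set (E d)} (hO : IsOpen O)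
    [IsProbabilityMeasure (volume.restrict O)] (hvol : volume O = 1) (hctrl : Controls O O O) :
    ∃ C : ℝ, 0 ≤ C ∧ ∀ k ∈ densityPairs O, ∀ k' ∈ densityPairs O,
      ‖k.1 - k'.1‖ ≤ C * ‖k.2 - k'.2‖ := by
  obtain ⟨C, hC, h⟩ := exists_poincare hO hvol hctrl
  refine ⟨C, hC, fun k hk k' hk' => ?_⟩
  have hne : volume O ≠ ⊤ := by simp [hvol]
  have hsub := (mem_sobolevSubmodule hne _).1 ((sobolevSubmodule O).sub_mem hk.2 hk'.2)
  have hmean : ∫ x in O, (k.1 - k'.1) x = 0 := by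
    rw [← inner_oneLp (Lp.memLp (k.1 - k'.1)), Lp.toLp_coeFn, inner_sub_right, hk.1.2, hk'.1.2,
      sub_self]
  have := h _ _ (Lp.memLp (k.1 - k'.1)) (Lp.memLp (k.2 - k'.2)) hsub hmean
  rw [Lp.norm_def, Lp.norm_def, ← ENNReal.toReal_ofReal hC, ← ENNReal.toReal_mul]
  exact ENNReal.toReal_mono (ENNReal.mul_ne_top (by simp) (Lp.eLpNorm_ne_top _)) this

/-! ### Maximization with the Dirichlet energy -/

/-- Square integrable densities with a square integrable weak gradient have finite energy, and the
functional of the Dirichlet energy is quadratic on them. -/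
theorem functional_dirichletEnergy {d m : ℕ} {Ω : Set (E d)}
    (hΩ : volume.restrict Ω = volume.restrict (interior Ω)) {β : ℝ} {r : E d → E m}
    (hr : MemLp (fun x => ‖r x‖ ^ 2) 2 (volume.restrict (interior Ω))) {p : E d → ℝ}
    {g : E d → E d} (hp : MemLp p 2 (volume.restrict (interior Ω)))
    (hg : MemLp g 2 (volume.restrict (interior Ω)))
    (hp0 : 0 ≤ᵐ[volume.restrict (interior Ω)] p) (hpg : IsWeakGradient (interior Ω) p g) :
    functional Ω β (dirichletEnergy Ω) r p =
      ((inner ℝ (hr.toLp _) (hp.toLp p) - β * ‖hg.toLp g‖ ^ 2 : ℝ) : EReal) := by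
  have h1 : ∫⁻ x in Ω, ENNReal.ofReal (‖r x‖ ^ 2 * p x)
      = ENNReal.ofReal (inner ℝ (hr.toLp _) (hp.toLp p)) := by
    rw [hΩ, ← integral_mul_eq_inner hr hp, ofReal_integral_eq_lintegral_ofReal]
    · exact hr.integrable_mul hp
    · filter_upwards [hp0] with x hx using mul_nonneg (sq_nonneg _) hx
  have h1' : 0 ≤ inner ℝ (hr.toLp _) (hp.toLp p) := by
    rw [← integral_mul_eq_inner hr hp]
    refine integral_nonneg_of_ae ?_
    filter_upwards [hp0] with x hx using mul_nonneg (sq_nonneg _) hx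
  have h2 : ∫⁻ x in interior Ω, ‖weakGradient (interior Ω) p x‖ₑ ^ 2
      = ENNReal.ofReal (‖hg.toLp g‖ ^ 2) := by
    rw [lintegral_congr_ae ((hpg.weakGradient_ae_eq isOpen_interior).mono
      fun x hx => by rw [hx]), ← eLpNorm_two_sq, Lp.norm_toLp,
      ENNReal.ofReal_pow ENNReal.toReal_nonneg, ENNReal.ofReal_toReal hg.eLpNorm_ne_top]
  rw [functional, dirichletEnergy, h1, h2, EReal.coe_ennreal_ofReal, EReal.coe_ennreal_ofReal,
    max_eq_left h1', max_eq_left (sq_nonneg _)]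
  norm_cast

theorem isDensity_iff {d : ℕ} {Ω : Set (E d)} {p : E d → ℝ}
    (hp : IntegrableOn p Ω) :
    IsDensity Ω p ↔ 0 ≤ᵐ[volume.restrict Ω] p ∧ ∫ x in Ω, p x = 1 := by
  constructor
  · rintro ⟨-, h0, h1⟩
    refine ⟨h0, ?_⟩
    rw [integral_eq_lintegral_of_nonneg_ae h0 hp.1, h1]; simp
  · rintro ⟨h0, h1⟩
    refine ⟨hp.1.aemeasurable, h0, ?_⟩
    rw [← ofReal_integral_eq_lintegral_ofReal hp h0, h1]; simp

/-- The densities of class `H¹` are the pairs in `densityPairs`. -/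
theorem exists_pair_of_mem_h1Densities {d : ℕ} {Ω : Set (E d)}
    (hΩ : volume.restrict Ω = volume.restrict (interior Ω))
    [IsProbabilityMeasure (volume.restrict (interior Ω))] (hvol : volume (interior Ω) ≠ ⊤)
    {p : E d → ℝ} (h : p ∈ h1Densities Ω) :
    ∃ (g : E d → E d) (hp : MemLp p 2 (volume.restrict (interior Ω)))
      (hg : MemLp g 2 (volume.restrict (interior Ω))),
      0 ≤ᵐ[volume.restrict (interior Ω)] p ∧ IsWeakGradient (interior Ω) p g ∧
      (hp.toLp p, hg.toLp g) ∈ densityPairs (interior Ω) := by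
  obtain ⟨hd, hp, g, hpg, hg⟩ := h
  have hi : IntegrableOn p Ω := by
    rw [IntegrableOn, hΩ]; exact hp.integrable (by norm_num)
  have hd' := (isDensity_iff hi).1 hd
  rw [hΩ] at hd'
  exact ⟨g, hp, hg, hd'.1, hpg, (toLp_mem_densityPairs hvol hp hg).2 ⟨hd', hpg⟩⟩

theorem mem_h1Densities_of_mem_densityPairs {d : ℕ} {Ω : Set (E d)}
    (hΩ : volume.restrict Ω = volume.restrict (interior Ω))
    [IsProbabilityMeasure (volume.restrict (interior Ω))] (hvol : volume (interior Ω) ≠ ⊤)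
    {k : Lp ℝ 2 (volume.restrict (interior Ω)) × Lp (E d) 2 (volume.restrict (interior Ω))}
    (hk : k ∈ densityPairs (interior Ω)) :
    (k.1 : E d → ℝ) ∈ h1Densities Ω ∧ 0 ≤ᵐ[volume.restrict (interior Ω)] k.1 ∧
      IsWeakGradient (interior Ω) k.1 k.2 := by
  have h := (toLp_mem_densityPairs hvol (Lp.memLp k.1) (Lp.memLp k.2)).1
    (by rwa [Lp.toLp_coeFn, Lp.toLp_coeFn])
  have hi : IntegrableOn k.1 Ω := by
    rw [IntegrableOn, hΩ]; exact (Lp.memLp k.1).integrable (by norm_num)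
  refine ⟨⟨(isDensity_iff hi).2 (by rw [hΩ]; exact h.1), Lp.memLp k.1, k.2, h.2, Lp.memLp k.2⟩,
    h.1.1, h.2⟩

/-- Subtracting a constant does not change the weak gradient, and √(a² + b²) ≤ a + b. -/
theorem h1Norm_sub_one_le {d : ℕ} {O : Set (E d)} (hO : IsOpen O)
    [IsProbabilityMeasure (volume.restrict O)] (hvol : volume O ≠ ⊤) {p : E d → ℝ} {g : E d → E d}
    (hp : MemLp p 2 (volume.restrict O)) (hg : MemLp g 2 (volume.restrict O))
    (hpg : IsWeakGradient O p g) :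
    h1Norm O (fun x => p x - 1)
      ≤ ENNReal.ofReal (‖hp.toLp p - oneLp O‖ + ‖hg.toLp g‖) := by
  have h1 : IsWeakGradient O (fun x => p x - 1) g := by
    have hp1 := hp.sub (memLp_const (μ := volume.restrict O) (1 : ℝ))
    refine (mem_sobolevSubmodule_toLp hvol hp1 hg).1 ?_
    have := (sobolevSubmodule O).sub_mem ((mem_sobolevSubmodule_toLp hvol hp hg).2 hpg)
      ((mem_sobolevSubmodule_toLp hvol (memLp_const 1) (MemLp.zero' (ε := E d))).2
        (isWeakGradient_const hvol 1))
    convert this using 1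
    refine Prod.ext (MemLp.toLp_sub hp (memLp_const 1)) ?_
    change _ = hg.toLp g - MemLp.toLp (0 : E d → E d) MemLp.zero'
    rw [MemLp.toLp_zero, sub_zero]
  have h2 : eLpNorm (fun x => p x - 1) 2 (volume.restrict O)
      = ENNReal.ofReal ‖hp.toLp p - oneLp O‖ := by
    rw [oneLp, ← MemLp.toLp_sub, Lp.norm_toLp, ENNReal.ofReal_toReal]
    · rfl
    · exact (hp.sub (memLp_const _)).eLpNorm_ne_top
  have h3 : eLpNorm (weakGradient O fun x => p x - 1) 2 (volume.restrict O)
      = ENNReal.ofReal ‖hg.toLp g‖ := by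
    rw [eLpNorm_congr_ae (h1.weakGradient_ae_eq hO), Lp.norm_toLp,
      ENNReal.ofReal_toReal hg.eLpNorm_ne_top]
  rw [h1Norm, h2, h3, ENNReal.ofReal_add (norm_nonneg _) (norm_nonneg _)]
  set a := ENNReal.ofReal ‖hp.toLp p - oneLp O‖
  set b := ENNReal.ofReal ‖hg.toLp g‖
  calc (a ^ 2 + b ^ 2) ^ (1 / 2 : ℝ) ≤ ((a + b) ^ 2) ^ (1 / 2 : ℝ) := by
        refine ENNReal.rpow_le_rpow ?_ (by norm_num)
        calc a ^ 2 + b ^ 2 ≤ a ^ 2 + b ^ 2 + 2 * a * b := le_self_add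
          _ = _ := by ring
    _ = a + b := by
        rw [← ENNReal.rpow_natCast, ← ENNReal.rpow_mul]; norm_num

/-- The maximization of the functional of the Dirichlet energy over the densities of class `H¹`:
a bound for all densities, and a maximizer close to the uniform density. -/
theorem dirichlet_maximization {d : ℕ} {Ω : Set (E d)} (hΩ : IsCompact Ω) (hvol : volume Ω = 1)
    (hL : HasLipschitzBoundary Ω) (hconn : IsConnected Ω) {β : ℝ} (hβ : 0 < β) :
    ∃ C : ℝ, 0 ≤ C ∧ ∀ {m : ℕ} (r : E d → E m), AEStronglyMeasurable r (volume.restrict Ω) →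
      sqNormL2 Ω r < ⊤ →
      (∀ p ∈ h1Densities Ω, functional Ω β (dirichletEnergy Ω) r p
        ≤ (((sqNormL2 Ω r).toReal + ((sqNormL2 Ω r).toReal * C) ^ 2 / β : ℝ) : EReal)) ∧
      ∃ p ∈ h1Densities Ω, IsMaxOn (functional Ω β (dirichletEnergy Ω) r) (h1Densities Ω) p ∧
        h1Norm (interior Ω) (fun x => p x - 1)
          ≤ ENNReal.ofReal ((C + 1) * ((sqNormL2 Ω r).toReal * C / β)) := by
  -- Densities are normalized on Ω while Sobolev regularity refers to the interior; the null
  -- boundary reconciles the two.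
  have hae : (interior Ω : Set (E d)) =ᵐ[volume] Ω :=
    interior_ae_eq_of_null_frontier (hL.volume_frontier hΩ.isClosed)
  have hres : volume.restrict Ω = volume.restrict (interior Ω) :=
    (Measure.restrict_congr_set hae).symm
  have hvolI : volume (interior Ω) = 1 := by rw [measure_congr hae, hvol]
  have hne : volume (interior Ω) ≠ ⊤ := by simp [hvolI]
  have : IsProbabilityMeasure (volume.restrict (interior Ω)) := ⟨by simp [hvolI]⟩
  obtain ⟨C, hC, hPoin⟩ := norm_sub_le_of_mem_densityPairs isOpen_interior hvolI
    (controls_interior hΩ hL hconn.isPreconnected)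
  have hone := one_mem_densityPairs (O := interior Ω) hne
  refine ⟨C, hC, fun {m} r hrm hfin => ?_⟩
  have hr : MemLp (fun x => ‖r x‖ ^ 2) 2 (volume.restrict (interior Ω)) := by
    rw [← hres]
    exact ⟨hrm.norm.pow 2, hfin⟩
  set R := hr.toLp _
  have hR : (sqNormL2 Ω r).toReal = ‖R‖ := by rw [Lp.norm_toLp, sqNormL2, hres]
  rw [hR]
  have hdist : ∀ k ∈ densityPairs (interior Ω), ‖k.1 - oneLp _‖ ≤ C * ‖k.2‖ := fun k hk => by
    simpa using hPoin k hk _ hone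
  have hgrow : ∀ k ∈ densityPairs (interior Ω),
      inner ℝ R k.1 ≤ inner ℝ R (oneLp (interior Ω)) + ‖R‖ * C * ‖k.2‖ := by
    intro k hk
    have h1 : inner ℝ R k.1 - inner ℝ R (oneLp (interior Ω)) ≤ ‖R‖ * (C * ‖k.2‖) := by
      rw [← inner_sub_right]
      exact (real_inner_le_norm _ _).trans
        (mul_le_mul_of_nonneg_left (hdist k hk) (norm_nonneg _))
    linarith
  refine ⟨fun p hp => ?_, ?_⟩
  · obtain ⟨g, hpL, hgL, hp0, hpg, hk⟩ := exists_pair_of_mem_h1Densities hres hne hp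
    rw [functional_dirichletEnergy hres hr hpL hgL hp0 hpg, EReal.coe_le_coe_iff]
    have h1 := hgrow _ hk
    have h2 : inner ℝ R (oneLp (interior Ω)) ≤ ‖R‖ := by
      simpa [norm_oneLp] using real_inner_le_norm R (oneLp (interior Ω))
    set M := ‖R‖ * C
    set s := ‖hgL.toLp g‖
    -- The sharp constant is M²/(4β); the cruder one suffices.
    have h3 : M * s - β * s ^ 2 ≤ M ^ 2 / β := by
      rw [le_div_iff₀ hβ]
      nlinarith [sq_nonneg (M - 2 * β * s), sq_nonneg M]
    simp only at h1
    linarith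
  · obtain ⟨k, hk, hmax⟩ := exists_isMaxOn_sub_sq (isClosed_densityPairs (interior Ω))
      (convex_densityPairs _) ⟨_, hone⟩ (innerSL ℝ R) hβ hPoin
    obtain ⟨hmem, hk0, hkg⟩ := mem_h1Densities_of_mem_densityPairs hres hne hk
    have hFk := functional_dirichletEnergy (β := β) hres hr (Lp.memLp k.1) (Lp.memLp k.2) hk0 hkg
    rw [Lp.toLp_coeFn, Lp.toLp_coeFn] at hFk
    refine ⟨k.1, hmem, fun q hq => ?_, ?_⟩
    · obtain ⟨g, hqL, hgL, hq0, hqg, hkq⟩ := exists_pair_of_mem_h1Densities hres hne hq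
      change functional Ω β (dirichletEnergy Ω) r q ≤ functional Ω β (dirichletEnergy Ω) r k.1
      rw [functional_dirichletEnergy hres hr hqL hgL hq0 hqg, hFk, EReal.coe_le_coe_iff]
      exact hmax hkq
    -- The uniform density is a competitor. Together with the linear growth bound this gives β‖∇p‖²
    -- ≤ C‖R‖‖∇p‖, and the factor ‖∇p‖ is cancelled unless it is zero.
    · have h1 : inner ℝ R (oneLp (interior Ω)) ≤ inner ℝ R k.1 - β * ‖k.2‖ ^ 2 := by
        have := hmax hone
        simpa using this
      have h2 := hgrow k hk
      have h3 : ‖k.2‖ ≤ ‖R‖ * C / β := by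
        rw [le_div_iff₀ hβ]
        rcases (norm_nonneg k.2).eq_or_lt with h0 | h0
        · rw [← h0]; simpa using mul_nonneg (norm_nonneg R) hC
        · nlinarith
      have h4 := h1Norm_sub_one_le isOpen_interior hne (Lp.memLp k.1) (Lp.memLp k.2) hkg
      rw [Lp.toLp_coeFn, Lp.toLp_coeFn] at h4
      refine h4.trans (ENNReal.ofReal_le_ofReal ?_)
      calc ‖k.1 - oneLp (interior Ω)‖ + ‖k.2‖ ≤ (C + 1) * ‖k.2‖ := by linarith [hdist k hk]
        _ ≤ _ := by gcongr

/-! ### The uniform competitor and the passage to the infimum -/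

theorem one_mem_h1Densities {d : ℕ} {Ω : Set (E d)} (hvol : volume Ω = 1) :
    (fun _ => (1 : ℝ)) ∈ h1Densities Ω := by
  have hne : volume (interior Ω) ≠ ⊤ :=
    ((measure_mono interior_subset).trans_lt (by simp [hvol])).ne
  have : IsFiniteMeasure (volume.restrict (interior Ω)) := ⟨by simpa using hne.lt_top⟩
  exact ⟨⟨aemeasurable_const, Eventually.of_forall fun _ => zero_le_one, by simp [hvol]⟩,
    memLp_const 1, 0, isWeakGradient_const hne 1, MemLp.zero'⟩

theorem functional_dirichletEnergy_one_nonneg {d m : ℕ} {Ω : Set (E d)} (hvol : volume Ω = 1)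
    (β : ℝ) (r : E d → E m) : 0 ≤ functional Ω β (dirichletEnergy Ω) r fun _ => 1 := by
  have hne : volume (interior Ω) ≠ ⊤ :=
    ((measure_mono interior_subset).trans_lt (by simp [hvol])).ne
  have h : dirichletEnergy Ω (fun _ => 1) = 0 := by
    rw [dirichletEnergy, lintegral_congr_ae (((isWeakGradient_const hne 1).weakGradient_ae_eq
      isOpen_interior).mono fun x hx => by rw [hx])]
    simp
  rw [functional, h, mul_zero, sub_zero]
  exact EReal.coe_ennreal_nonneg _

theorem exists_seq_of_iInf_eq_zero {U : Type*} {N : U → ℝ≥0∞} (h : ⨅ u, N u = 0) :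
    ∃ u : ℕ → U, (∀ n, N (u n) < ⊤) ∧ Tendsto (fun n => N (u n)) atTop (𝓝 0) := by
  have h1 : ∀ n : ℕ, ∃ u, N u < ((n : ℝ≥0∞))⁻¹ := fun n =>
    iInf_lt_iff.1 (by rw [h]; simp)
  choose u hu using h1
  refine ⟨u, fun n => (hu n).trans_le le_top, ?_⟩
  exact tendsto_of_tendsto_of_tendsto_of_le_of_le tendsto_const_nhds
    ENNReal.tendsto_inv_nat_nhds_zero (fun n => zero_le) fun n => (hu n).le

/-- The values of the maxima tend to zero along a sequence if they are nonnegative and bounded in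
terms of a quantity that tends to zero. -/
theorem tendsto_zero_of_le_bound {f : ℕ → EReal} {N : ℕ → ℝ≥0∞} {B : ℝ → ℝ} (hB : Continuous B)
    (hB0 : B 0 = 0) (hN : Tendsto N atTop (𝓝 0)) (h0 : ∀ n, 0 ≤ f n)
    (hf : ∀ n, f n ≤ (B (N n).toReal : EReal)) : Tendsto f atTop (𝓝 0) := by
  have h1 : Tendsto (fun n => (B (N n).toReal : EReal)) atTop (𝓝 0) := by
    have h2 : Tendsto (fun n => (N n).toReal) atTop (𝓝 0) := by
      simpa [Function.comp_def] using (ENNReal.tendsto_toReal ENNReal.zero_ne_top).comp hN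
    have h3 := (hB.tendsto 0).comp h2
    rw [hB0] at h3
    exact (continuous_coe_real_ereal.tendsto 0).comp h3
  exact tendsto_of_tendsto_of_tendsto_of_le_of_le tendsto_const_nhds h1 h0 hf

/-- The fixed competitor `p₀` bounds every supremum from below by 0. Along a sequence with `N`
tending to 0, the upper bound squeezes the suprema to 0. -/
theorem iInf_iSup_eq_zero {U α : Type*} {J : U → α → EReal} {V : Set α} {N : U → ℝ≥0∞} {B : ℝ → ℝ}
    (hB : Continuous B) (hB0 : B 0 = 0) (hN : ⨅ u, N u = 0) {p₀ : α} (hp₀ : p₀ ∈ V)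
    (h0 : ∀ u, 0 ≤ J u p₀) (hJ : ∀ u, N u < ⊤ → ∀ p ∈ V, J u p ≤ (B (N u).toReal : EReal)) :
    ⨅ u, ⨆ p ∈ V, J u p = 0 := by
  have hsup : ∀ u, 0 ≤ ⨆ p ∈ V, J u p := fun u =>
    (h0 u).trans (le_iSup₂ (f := fun p (_ : p ∈ V) => J u p) p₀ hp₀)
  obtain ⟨u, hu, hlim⟩ := exists_seq_of_iInf_eq_zero hN
  refine le_antisymm ?_ (le_iInf hsup)
  exact ge_of_tendsto' (tendsto_zero_of_le_bound hB hB0 hlim (fun n => hsup (u n))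
    fun n => iSup₂_le (hJ (u n) (hu n))) fun n => iInf_le _ (u n)

/-! ### Maximization with the negative entropy -/

/-- The Gibbs density of a residual. -/
noncomputable def gibbsDensity {d m : ℕ} (Ω : Set (E d)) (β : ℝ) (r : E d → E m) (x : E d) : ℝ :=
  Real.exp (‖r x‖ ^ 2 / β) / ∫ y in Ω, Real.exp (‖r y‖ ^ 2 / β)

theorem continuousOn_and_le_of_sqNormC_lt_top {d m : ℕ} {Ω : Set (E d)} {r : E d → E m}
    (h : sqNormC Ω r < ⊤) : ContinuousOn (fun x => ‖r x‖ ^ 2) Ω ∧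
      ∀ x ∈ Ω, ‖r x‖ ^ 2 ≤ (sqNormC Ω r).toReal := by
  by_cases hc : ContinuousOn (fun x => ‖r x‖ ^ 2) Ω
  · refine ⟨hc, fun x hx => ?_⟩
    rw [← ENNReal.ofReal_le_iff_le_toReal h.ne, sqNormC, if_pos hc]
    exact le_iSup₂ (f := fun x (_ : x ∈ Ω) => ENNReal.ofReal (‖r x‖ ^ 2)) x hx
  · rw [sqNormC, if_neg hc] at h
    exact absurd h (lt_irrefl _)

/-- This is log t ≤ t - 1 at t = q/p, multiplied by p. Integrated over two densities, it says that
relative entropy is nonnegative. -/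
theorem mul_sub_mul_log_le {p q : ℝ} (hp : 0 ≤ p) (hq : 0 < q) :
    p * Real.log q - p * Real.log p ≤ q - p := by
  rcases hp.eq_or_lt with rfl | hp
  · simpa using hq.le
  have h := Real.log_le_sub_one_of_pos (div_pos hq hp)
  rw [Real.log_div hq.ne' hp.ne'] at h
  have h2 := mul_le_mul_of_nonneg_left h hp.le
  have h3 : p * (q / p - 1) = q - p := by field_simp
  linarith

theorem IsDensity.integrableOn {d : ℕ} {Ω : Set (E d)} {p : E d → ℝ} (h : IsDensity Ω p) :
    IntegrableOn p Ω := by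
  refine ⟨h.1.aestronglyMeasurable, ?_⟩
  rw [hasFiniteIntegral_iff_ofReal h.2.1, h.2.2]
  exact ENNReal.one_lt_top

open Classical in
/-- The functional of the negative entropy at a density, for a bounded residual. -/
theorem functional_negEntropy {d m : ℕ} {Ω : Set (E d)} {β : ℝ} (hβ : 0 < β) {r : E d → E m}
    {p : E d → ℝ} (hp : IsDensity Ω p) (hrp : IntegrableOn (fun x => ‖r x‖ ^ 2 * p x) Ω) :
    functional Ω β (negEntropy Ω) r p =
      if IntegrableOn (fun x => p x * Real.log (p x)) Ω volume then
        (((∫ x in Ω, ‖r x‖ ^ 2 * p x) - β * ∫ x in Ω, p x * Real.log (p x) : ℝ) : EReal)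
      else ⊥ := by
  have h0 : 0 ≤ᵐ[volume.restrict Ω] fun x => ‖r x‖ ^ 2 * p x :=
    hp.2.1.mono fun x hx => mul_nonneg (sq_nonneg _) hx
  rw [functional, negEntropy, ← ofReal_integral_eq_lintegral_ofReal hrp h0, EReal.coe_ennreal_ofReal,
    max_eq_left (integral_nonneg_of_ae h0)]
  split_ifs
  · norm_cast
  · rw [EReal.coe_mul_top_of_pos hβ, EReal.sub_top]

/-- The Gibbs density maximizes the functional of the negative entropy, and is close to the uniform
density if the residual is small. -/
theorem gibbs_maximization {d m : ℕ} {Ω : Set (E d)} (hΩ : IsCompact Ω) (hvol : volume Ω = 1)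
    {β : ℝ} (hβ : 0 < β) {r : E d → E m} (hfin : sqNormC Ω r < ⊤) :
    gibbsDensity Ω β r ∈ densities Ω ∧
    (∀ p ∈ densities Ω, functional Ω β (negEntropy Ω) r p ≤ ((sqNormC Ω r).toReal : EReal)) ∧
    IsMaxOn (functional Ω β (negEntropy Ω) r) (densities Ω) (gibbsDensity Ω β r) ∧
    (∀ x, 0 < gibbsDensity Ω β r x) ∧
    ∀ x ∈ Ω, |gibbsDensity Ω β r x - 1| ≤ Real.exp ((sqNormC Ω r).toReal / β) - 1 := by
  obtain ⟨hc, hM⟩ := continuousOn_and_le_of_sqNormC_lt_top hfin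
  set M := (sqNormC Ω r).toReal
  have hprob : IsProbabilityMeasure (volume.restrict Ω) := ⟨by simp [hvol]⟩
  have hΩm := hΩ.measurableSet
  have hce : ContinuousOn (fun x => Real.exp (‖r x‖ ^ 2 / β)) Ω :=
    Real.continuous_exp.comp_continuousOn (hc.div_const β)
  have hie := hce.integrableOn_compact (μ := volume) hΩ
  set Z := ∫ y in Ω, Real.exp (‖r y‖ ^ 2 / β) with hZ
  set q := gibbsDensity Ω β r with hq
  have hqx : ∀ x, q x = Real.exp (‖r x‖ ^ 2 / β) / Z := fun x => rfl
  have hexp1 : ∀ x, 1 ≤ Real.exp (‖r x‖ ^ 2 / β) := fun x => Real.one_le_exp (by positivity)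
  have hexp2 : ∀ x ∈ Ω, Real.exp (‖r x‖ ^ 2 / β) ≤ Real.exp (M / β) := fun x hx =>
    Real.exp_le_exp.2 (by gcongr; exact hM x hx)
  have hZ1 : 1 ≤ Z := by
    have := integral_mono (integrable_const (1 : ℝ)) hie fun x => hexp1 x
    simpa using this
  have hZ2 : Z ≤ Real.exp (M / β) := by
    have := setIntegral_mono_on hie (integrable_const (Real.exp (M / β))) hΩm hexp2
    simpa [hvol, Measure.real] using this
  have hZ0 : 0 < Z := by linarith
  have hqpos : ∀ x, 0 < q x := fun x => div_pos (Real.exp_pos _) hZ0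
  have hlogq : ∀ x, Real.log (q x) = ‖r x‖ ^ 2 / β - Real.log Z := fun x => by
    rw [hqx, Real.log_div (Real.exp_pos _).ne' hZ0.ne', Real.log_exp]
  have hqi : IntegrableOn q Ω := hie.div_const Z
  have hqint : ∫ x in Ω, q x = 1 := by
    simp only [hqx]
    rw [integral_div, ← hZ, div_self hZ0.ne']
  have hqd : IsDensity Ω q :=
    (isDensity_iff hqi).2 ⟨Eventually.of_forall fun x => (hqpos x).le, hqint⟩
  have hmul : ∀ p, IsDensity Ω p → IntegrableOn (fun x => ‖r x‖ ^ 2 * p x) Ω := fun p hp =>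
    hp.integrableOn.bdd_mul (hc.aestronglyMeasurable hΩm)
      ((ae_restrict_iff' hΩm).2 (Eventually.of_forall fun x hx => by
        rw [Real.norm_of_nonneg (sq_nonneg _)]; exact hM x hx))
  have hbound : ∀ p, IsDensity Ω p →
      functional Ω β (negEntropy Ω) r p ≤ ((β * Real.log Z : ℝ) : EReal) := by
    intro p hp
    rw [functional_negEntropy hβ hp (hmul p hp)]
    split_ifs with hpl
    · rw [EReal.coe_le_coe_iff]
      have hpint := ((isDensity_iff hp.integrableOn).1 hp).2
      have e : ∀ x, p x * Real.log (q x) - p x * Real.log (p x) =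
          (‖r x‖ ^ 2 * p x / β - Real.log Z * p x) - p x * Real.log (p x) := fun x => by
        rw [hlogq]; ring
      have i1 : IntegrableOn (fun x => ‖r x‖ ^ 2 * p x / β) Ω := (hmul p hp).div_const β
      have i2 : IntegrableOn (fun x => Real.log Z * p x) Ω := hp.integrableOn.const_mul _
      have i12 : IntegrableOn (fun x => ‖r x‖ ^ 2 * p x / β - Real.log Z * p x) Ω := i1.sub i2
      -- The right side is 1 - 1 = 0. On the left, log q = |r|²/β - log Z turns the inequality into
      -- the bound by β log Z.
      have h1 : ∫ x in Ω, (p x * Real.log (q x) - p x * Real.log (p x)) ≤ ∫ x in Ω, (q x - p x) := by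
        refine integral_mono_ae ?_ (hqi.sub hp.integrableOn)
          (hp.2.1.mono fun x hx => mul_sub_mul_log_le hx (hqpos x))
        simp only [e]
        exact i12.sub hpl
      simp only [e] at h1
      rw [integral_sub hqi hp.integrableOn, integral_sub i12 hpl, integral_sub i1 i2, integral_div,
        integral_const_mul, hqint, hpint] at h1
      have h2 : (∫ x in Ω, ‖r x‖ ^ 2 * p x) / β
          ≤ Real.log Z + ∫ x in Ω, p x * Real.log (p x) := by linarith
      rw [div_le_iff₀ hβ] at h2
      linarith
    · exact bot_le
  have hval : functional Ω β (negEntropy Ω) r q = ((β * Real.log Z : ℝ) : EReal) := by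
    have e : ∀ x, q x * Real.log (q x) = ‖r x‖ ^ 2 * q x / β - Real.log Z * q x := fun x => by
      rw [hlogq]; ring
    have i1 : IntegrableOn (fun x => ‖r x‖ ^ 2 * q x / β) Ω := (hmul q hqd).div_const β
    have i2 : IntegrableOn (fun x => Real.log Z * q x) Ω := hqi.const_mul _
    have i3 : IntegrableOn (fun x => q x * Real.log (q x)) Ω := by
      simp only [e]
      exact i1.sub i2
    rw [functional_negEntropy hβ hqd (hmul q hqd), if_pos i3]
    simp only [e]
    rw [integral_sub i1 i2, integral_div, integral_const_mul, hqint]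
    congr 1
    field_simp
    ring
  have hlogZ : β * Real.log Z ≤ M := by
    have := Real.log_le_log hZ0 hZ2
    rw [Real.log_exp, le_div_iff₀ hβ] at this
    linarith
  refine ⟨hqd, fun p hp => (hbound p hp).trans (EReal.coe_le_coe_iff.2 hlogZ), fun p hp => ?_,
    hqpos, fun x hx => ?_⟩
  · change functional Ω β (negEntropy Ω) r p ≤ functional Ω β (negEntropy Ω) r q
    rw [hval]
    exact hbound p hp
  · have h1 : q x ≤ Real.exp (M / β) :=
      (div_le_self (Real.exp_pos _).le hZ1).trans (hexp2 x hx)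
    have h2 : (Real.exp (M / β))⁻¹ ≤ q x := by
      rw [hqx, inv_eq_one_div]
      gcongr
      exact hexp1 x
    -- The density lies between exp(-M/β) and exp(M/β). This inequality shows that the lower
    -- deviation from 1 is no larger than the upper one.
    have h3 : 2 ≤ Real.exp (M / β) + (Real.exp (M / β))⁻¹ := by
      have hpos := Real.exp_pos (M / β)
      rw [← sub_nonneg]
      have : Real.exp (M / β) + (Real.exp (M / β))⁻¹ - 2
          = (Real.exp (M / β) - 1) ^ 2 / Real.exp (M / β) := by field_simp; ring
      rw [this]; positivity
    rw [abs_le]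
    constructor <;> linarith

/-! ### The two minimax statements -/

theorem one_mem_densities {d : ℕ} {Ω : Set (E d)} (hvol : volume Ω = 1) :
    (fun _ => (1 : ℝ)) ∈ densities Ω :=
  ⟨aemeasurable_const, Eventually.of_forall fun _ => zero_le_one, by simp [hvol]⟩

theorem functional_negEntropy_one_nonneg {d m : ℕ} (Ω : Set (E d))
    (β : ℝ) (r : E d → E m) : 0 ≤ functional Ω β (negEntropy Ω) r fun _ => 1 := by
  have h : negEntropy Ω (fun _ => 1) = 0 := by simp [negEntropy]
  rw [functional, h, mul_zero, sub_zero]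
  exact EReal.coe_ennreal_nonneg _

theorem dirichlet_minimax {d m : ℕ} {U : Type*} {Ω : Set (E d)} (hΩ : IsCompact Ω)
    (hvol : volume Ω = 1) {β : ℝ} (hβ : 0 < β) {r : U → E d → E m}
    (hr : ∀ u, AEStronglyMeasurable (r u) (volume.restrict Ω)) (hL : HasLipschitzBoundary Ω)
    (hconn : IsConnected Ω) (hinf : ⨅ u, sqNormL2 Ω (r u) = 0) :
    (⨅ u, ⨆ p ∈ h1Densities Ω, functional Ω β (dirichletEnergy Ω) (r u) p) = 0 ∧
    ∀ u : ℕ → U, (∀ n, sqNormL2 Ω (r (u n)) < ⊤) →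
      Tendsto (fun n => sqNormL2 Ω (r (u n))) atTop (𝓝 0) →
      ∃ p : ℕ → E d → ℝ,
        (∀ n, p n ∈ h1Densities Ω ∧
          IsMaxOn (functional Ω β (dirichletEnergy Ω) (r (u n))) (h1Densities Ω) (p n)) ∧
        Tendsto (fun n => functional Ω β (dirichletEnergy Ω) (r (u n)) (p n)) atTop (𝓝 0) ∧
        Tendsto (fun n => h1Norm (interior Ω) (fun x => p n x - 1)) atTop (𝓝 0) := by
  obtain ⟨C, -, h⟩ := dirichlet_maximization hΩ hvol hL hconn hβ
  have h1 := one_mem_h1Densities hvol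
  have h10 := fun u => functional_dirichletEnergy_one_nonneg hvol β (r u)
  have hB : Continuous fun a : ℝ => a + (a * C) ^ 2 / β := by fun_prop
  refine ⟨iInf_iSup_eq_zero hB (by simp) hinf h1 h10 fun u hu => (h (r u) (hr u) hu).1,
    fun u hu hlim => ?_⟩
  choose p hp hmax hnorm using fun n => (h (r (u n)) (hr (u n)) (hu n)).2
  refine ⟨p, fun n => ⟨hp n, hmax n⟩, tendsto_zero_of_le_bound hB (by simp) hlim
    (fun n => (h10 (u n)).trans (hmax n h1))
    (fun n => (h _ (hr (u n)) (hu n)).1 _ (hp n)), ?_⟩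
  have hlim' : Tendsto (fun n => (sqNormL2 Ω (r (u n))).toReal) atTop (𝓝 0) := by
    simpa [Function.comp_def] using (ENNReal.tendsto_toReal ENNReal.zero_ne_top).comp hlim
  have hcont : Continuous fun a : ℝ => ENNReal.ofReal ((C + 1) * (a * C / β)) :=
    ENNReal.continuous_ofReal.comp (by fun_prop)
  have hz := (hcont.tendsto 0).comp hlim'
  simp only [zero_mul, zero_div, mul_zero, ENNReal.ofReal_zero] at hz
  exact tendsto_of_tendsto_of_tendsto_of_le_of_le tendsto_const_nhds hz (fun n => zero_le) hnorm

theorem entropy_minimax {d m : ℕ} {U : Type*} {Ω : Set (E d)} (hΩ : IsCompact Ω)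
    (hvol : volume Ω = 1) {β : ℝ} (hβ : 0 < β) {r : U → E d → E m}
    (hinf : ⨅ u, sqNormC Ω (r u) = 0) :
    (⨅ u, ⨆ p ∈ densities Ω, functional Ω β (negEntropy Ω) (r u) p) = 0 ∧
    ∀ u : ℕ → U, (∀ n, sqNormC Ω (r (u n)) < ⊤) →
      Tendsto (fun n => sqNormC Ω (r (u n))) atTop (𝓝 0) →
      ∃ p : ℕ → E d → ℝ,
        (∀ n, p n ∈ densities Ω ∧
          IsMaxOn (functional Ω β (negEntropy Ω) (r (u n))) (densities Ω) (p n)) ∧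
        Tendsto (fun n => functional Ω β (negEntropy Ω) (r (u n)) (p n)) atTop (𝓝 0) ∧
        (∀ n, ∀ x ∈ Ω, p n x = Real.exp (‖r (u n) x‖ ^ 2 / β) /
          ∫ y in Ω, Real.exp (‖r (u n) y‖ ^ 2 / β)) ∧
        (∀ n, ∀ x ∈ Ω, 0 < p n x) ∧
        TendstoUniformlyOn p (fun _ => 1) atTop Ω := by
  have h := fun u (hu : sqNormC Ω (r u) < ⊤) => gibbs_maximization hΩ hvol hβ hu
  have h1 := one_mem_densities hvol
  have h10 := fun u => functional_negEntropy_one_nonneg Ω β (r u)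
  refine ⟨iInf_iSup_eq_zero continuous_id rfl hinf h1 h10 fun u hu => (h u hu).2.1,
    fun u hu hlim => ⟨fun n => gibbsDensity Ω β (r (u n)),
      fun n => ⟨(h _ (hu n)).1, (h _ (hu n)).2.2.1⟩,
      tendsto_zero_of_le_bound continuous_id rfl hlim
        (fun n => (h10 (u n)).trans ((h _ (hu n)).2.2.1 h1))
        (fun n => (h _ (hu n)).2.1 _ (h _ (hu n)).1),
      fun n x _ => rfl, fun n x _ => (h _ (hu n)).2.2.2.1 x, ?_⟩⟩
  have hlim' : Tendsto (fun n => (sqNormC Ω (r (u n))).toReal) atTop (𝓝 0) := by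
    simpa [Function.comp_def] using (ENNReal.tendsto_toReal ENNReal.zero_ne_top).comp hlim
  have hcont : Continuous fun a : ℝ => Real.exp (a / β) - 1 := by fun_prop
  have hz := (hcont.tendsto 0).comp hlim'
  simp only [zero_div, Real.exp_zero, sub_self] at hz
  refine Metric.tendstoUniformlyOn_iff.2 fun ε hε => ?_
  filter_upwards [hz.eventually_lt_const hε] with n hn x hx
  rw [dist_comm, Real.dist_eq]
  exact ((h _ (hu n)).2.2.2.2 x hx).trans_lt hn

end AAS

theorem theorem1 {d m : ℕ} {U : Type*} (Ω : Set (AAS.E d)) (hΩ : IsCompact Ω)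
    (hvol : volume Ω = 1) (β : ℝ) (hβ : 0 < β) (r : U → AAS.E d → AAS.E m)
    (hr : ∀ u, AEStronglyMeasurable (r u) (volume.restrict Ω)) :
    -- the Dirichlet energy
    (AAS.HasLipschitzBoundary Ω → IsConnected Ω → (⨅ u, AAS.sqNormL2 Ω (r u)) = 0 →
      (⨅ u, ⨆ p ∈ AAS.h1Densities Ω, AAS.functional Ω β (AAS.dirichletEnergy Ω) (r u) p) = 0 ∧
      ∀ u : ℕ → U, (∀ n, AAS.sqNormL2 Ω (r (u n)) < ⊤) →
        Tendsto (fun n => AAS.sqNormL2 Ω (r (u n))) atTop (𝓝 0) →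
        ∃ p : ℕ → AAS.E d → ℝ,
          (∀ n, p n ∈ AAS.h1Densities Ω ∧
            IsMaxOn (AAS.functional Ω β (AAS.dirichletEnergy Ω) (r (u n)))
              (AAS.h1Densities Ω) (p n)) ∧
          Tendsto (fun n => AAS.functional Ω β (AAS.dirichletEnergy Ω) (r (u n)) (p n))
            atTop (𝓝 0) ∧
          Tendsto (fun n => AAS.h1Norm (interior Ω) (fun x => p n x - 1)) atTop (𝓝 0)) ∧
    -- the negative entropy
    ((⨅ u, AAS.sqNormC Ω (r u)) = 0 →
      (⨅ u, ⨆ p ∈ AAS.densities Ω, AAS.functional Ω β (AAS.negEntropy Ω) (r u) p) = 0 ∧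
      ∀ u : ℕ → U, (∀ n, AAS.sqNormC Ω (r (u n)) < ⊤) →
        Tendsto (fun n => AAS.sqNormC Ω (r (u n))) atTop (𝓝 0) →
        ∃ p : ℕ → AAS.E d → ℝ,
          (∀ n, p n ∈ AAS.densities Ω ∧
            IsMaxOn (AAS.functional Ω β (AAS.negEntropy Ω) (r (u n)))
              (AAS.densities Ω) (p n)) ∧
          Tendsto (fun n => AAS.functional Ω β (AAS.negEntropy Ω) (r (u n)) (p n))
            atTop (𝓝 0) ∧
          (∀ n, ∀ x ∈ Ω, p n x = Real.exp (‖r (u n) x‖ ^ 2 / β) /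
            ∫ y in Ω, Real.exp (‖r (u n) y‖ ^ 2 / β)) ∧
          (∀ n, ∀ x ∈ Ω, 0 < p n x) ∧
          TendstoUniformlyOn p (fun _ => 1) atTop Ω) := by
  exact ⟨AAS.dirichlet_minimax hΩ hvol hβ hr, AAS.entropy_minimax hΩ hvol hβ⟩
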